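/- Let $N\ge 1$ be an integer and $0<\lambda\le\Lambda$ with $\tilde N_+:=\frac{\lambda}{\Lambda}(N-1)+1>2$. For a symmetric matrix $A$ with eigenvalues $\mu_1,\dots,\mu_N$ let $\mathcal M^+_{\lambda,\Lambda}(A)=\Lambda\sum_{\mu_i>0}\mu_i+\lambda\sum_{\mu_i<0}\mu_i$, and for $p>1$ consider the radial $C^2$ solutions of $$-\mathcal M^+_{\lambda,\Lambda}(D^2u)=u^{p},\qquad u\ge 0\qquad\text{in }\mathbb R^N. \tag{1}$$ Writing $u(r)$, $r=|x|$, for the profile of a radial function $u$, a radial solution is called fast decaying if $r^{\tilde N_+-2}u(r)\to c$ and $r^{\tilde N_+-1}u'(r)\to-(\tilde N_+-2)c$ as $r\to+\infty$ for some $c>0$. Let $p^\star>1$ be the critical exponent, i.e. the exponent for which (1) with $p=p^\star$ has a fast decaying radial solution. Let $X$ be the set of all positive radial $u\in C^2(\mathbb R^N)$ for which there is $r_0=r_0(u)\in(0,+\infty)$ such that $u''(r_0)=0$, $u''(r)<0$ for $r\in(0,r_0)$ and $u''(r)>0$ for $r>r_0$. For $u\in X$ put $$E^\star_+(u)=\int_{\mathbb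 R^N}u^{p^\star+1}(x)\,g_u(x)\,dx\in[0,+\infty],\qquad g_u(x)=\begin{cases}r_0^{\gamma^\star}&\text{if }|x|\le r_0,\\ |x|^{\gamma^\star}&\text{if }|x|>r_0,\end{cases}\qquad \gamma^\star=2\,\frac{p^\star+1}{p^\star-1}-N,$$ and for $\alpha>0$ let $u_\alpha(x)=\alpha\,u\big(\alpha^{\frac{p^\star-1}{2}}x\big)$. Then: (i) for every $u\in X$ and every $\alpha>0$ one has $u_\alpha\in X$ and $E^\star_+(u_\alpha)=E^\star_+(u)$; (ii) there is a finite number $\Sigma^+$ such that, if $U^+$ is a radial solution of (1) with $p=p^\star$ and $U^+(0)=1$, then $U^+\in X$, and for every $\alpha>0$ the function $U^+_\alpha$ is a solution of (1) with $p=p^\star$, belongs to $X$, and satisfies $$E^\star_+(U^+_\alpha)=E^\star_+(U^+)=\Sigma^+<+\infty .$$ -/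

import Mathlib

open MeasureTheory Filter Topology
open scoped ENNReal NNReal

namespace PucciEnergy

noncomputable section

/-- The maximal Pucci operator `Λ ∑_{μ > 0} μ + λ ∑_{μ < 0} μ`, the sums being over the eigenvalues
of the (symmetric real) matrix `A`, counted with multiplicity. -/
def pucciMax {N : ℕ} (lam Lam : ℝ) (A : Matrix (Fin N) (Fin N) ℝ) : ℝ :=
  Lam * (A.charpoly.roots.filter (fun μ => 0 < μ)).sum
    + lam * (A.charpoly.roots.filter (fun μ => μ < 0)).sum

/-- The Hessian matrix `D²u(x)`. -/
def hessian {N : ℕ} (u : EuclideanSpace ℝ (Fin N) → ℝ) (x : EuclideanSpace ℝ (Fin N)) :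
    Matrix (Fin N) (Fin N) ℝ :=
  Matrix.of fun i j =>
    fderiv ℝ (fderiv ℝ u) x (EuclideanSpace.single i 1) (EuclideanSpace.single j 1)

/-- `u` is radial. -/
def IsRadial {N : ℕ} (u : EuclideanSpace ℝ (Fin N) → ℝ) : Prop :=
  ∀ x y, ‖x‖ = ‖y‖ → u x = u y

/-- The radial profile `r ↦ u(r)`, read along the first coordinate axis. -/
def profile {N : ℕ} [NeZero N] (u : EuclideanSpace ℝ (Fin N) → ℝ) (r : ℝ) : ℝ :=
  u (EuclideanSpace.single (0 : Fin N) r)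

/-- The dimension-like number `Ñ₊ = (λ/Λ)(N - 1) + 1`. -/
def dimPlus (N : ℕ) (lam Lam : ℝ) : ℝ := lam / Lam * ((N : ℝ) - 1) + 1

/-- Classical radial solutions of `-M⁺(D²u) = u^p`, `u ≥ 0` in `ℝ^N`. -/
structure IsRadialSolution {N : ℕ} (lam Lam p : ℝ) (u : EuclideanSpace ℝ (Fin N) → ℝ) :
    Prop where
  contDiff : ContDiff ℝ 2 u
  radial : IsRadial u
  nonneg : ∀ x, 0 ≤ u x
  equation : ∀ x, -pucciMax lam Lam (hessian u x) = u x ^ p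

/-- Fast decay: `r^(Ñ₊-2) u(r) → c` and `r^(Ñ₊-1) u'(r) → -(Ñ₊-2) c` as `r → ∞`, for some `c > 0`. -/
def IsFastDecaying {N : ℕ} [NeZero N] (lam Lam : ℝ) (u : EuclideanSpace ℝ (Fin N) → ℝ) : Prop :=
  ∃ c : ℝ, 0 < c ∧
    Tendsto (fun r : ℝ => r ^ (dimPlus N lam Lam - 2) * profile u r) atTop (𝓝 c) ∧
    Tendsto (fun r : ℝ => r ^ (dimPlus N lam Lam - 1) * deriv (profile u) r) atTop
      (𝓝 (-(dimPlus N lam Lam - 2) * c))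

/-- `p` is the critical exponent for the maximal Pucci operator: an exponent `p > 1` for which there
is a fast decaying radial solution in the whole space. -/
def IsCriticalExponent (N : ℕ) [NeZero N] (lam Lam p : ℝ) : Prop :=
  1 < p ∧ ∃ V : EuclideanSpace ℝ (Fin N) → ℝ,
    IsRadialSolution lam Lam p V ∧ IsFastDecaying lam Lam V

/-- `r₀ ∈ (0, ∞)` is the radius at which the radial function `u` changes convexity, `u` being concave
in `r` before and convex in `r` after. -/
structure IsInflectionRadius {N : ℕ} [NeZero N] (u : EuclideanSpace ℝ (Fin N) → ℝ) (r₀ : ℝ) :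
    Prop where
  pos : 0 < r₀
  zero : deriv (deriv (profile u)) r₀ = 0
  neg_before : ∀ r, 0 < r → r < r₀ → deriv (deriv (profile u)) r < 0
  pos_after : ∀ r, r₀ < r → 0 < deriv (deriv (profile u)) r

/-- The set `X` of positive radial `C²` functions on `ℝ^N` which change convexity exactly once. -/
def X (N : ℕ) [NeZero N] : Set (EuclideanSpace ℝ (Fin N) → ℝ) :=
  {u | ContDiff ℝ 2 u ∧ IsRadial u ∧ (∀ x, 0 < u x) ∧ ∃ r₀, IsInflectionRadius u r₀}

/-- The inflection radius `r₀(u)`; the set below has exactly one element when `u ∈ X`. -/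
def inflectionRadius {N : ℕ} [NeZero N] (u : EuclideanSpace ℝ (Fin N) → ℝ) : ℝ :=
  sInf {r | IsInflectionRadius u r}

theorem IsInflectionRadius.unique {N : ℕ} [NeZero N] {u : EuclideanSpace ℝ (Fin N) → ℝ} {r s : ℝ}
    (hr : IsInflectionRadius u r) (hs : IsInflectionRadius u s) : r = s := by
  rcases lt_trichotomy r s with h | h | h
  · exact absurd hr.zero (hs.neg_before r hr.pos h).ne
  · exact h
  · exact absurd hs.zero (hr.neg_before s hs.pos h).ne

theorem IsInflectionRadius.inflectionRadius_eq {N : ℕ} [NeZero N]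
    {u : EuclideanSpace ℝ (Fin N) → ℝ} {r : ℝ} (hr : IsInflectionRadius u r) :
    inflectionRadius u = r := by
  have h : {s | IsInflectionRadius u s} = {r} := by
    ext s
    exact ⟨fun hs => hs.unique hr, fun hs => by rw [Set.mem_singleton_iff.1 hs]; exact hr⟩
  rw [inflectionRadius, h, csInf_singleton]

/-- The exponent `γ* = 2 (p + 1)/(p - 1) - N`. -/
def gammaStar (N : ℕ) (p : ℝ) : ℝ := 2 * ((p + 1) / (p - 1)) - N

/-- The radial weight `g_u`. -/
def weight {N : ℕ} [NeZero N] (p : ℝ) (u : EuclideanSpace ℝ (Fin N) → ℝ)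
    (x : EuclideanSpace ℝ (Fin N)) : ℝ :=
  if ‖x‖ ≤ inflectionRadius u then inflectionRadius u ^ gammaStar N p else ‖x‖ ^ gammaStar N p

/-- The weighted energy `∫ u^(p+1) g_u dx`, with values in `[0, ∞]` (the integrand is positive for
`u ∈ X`). -/
def energy {N : ℕ} [NeZero N] (p : ℝ) (u : EuclideanSpace ℝ (Fin N) → ℝ) : ℝ≥0∞ :=
  ∫⁻ x, ENNReal.ofReal (u x ^ (p + 1) * weight p u x)

/-- The rescaling `u_α(x) = α u(α^((p-1)/2) x)`. -/
def rescale {N : ℕ} (p α : ℝ) (u : EuclideanSpace ℝ (Fin N) → ℝ) :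
    EuclideanSpace ℝ (Fin N) → ℝ :=
  fun x => α * u (α ^ ((p - 1) / 2) • x)

end

end PucciEnergy

/-! Put k = 2/(p-1). The equation is invariant under u(x) ↦ ρ^k u(ρx), and γ* is the exponent for
which p + 1 = (p-1)/2 · (γ* + N), so the weighted integral is invariant as well; (i) is a change of
variables. Let V be the given fast decaying solution. Uniqueness for the radial ODE at the origin
makes every solution with value 1 at 0 a rescaling of V, so (ii) reduces to `mem_X` and
`energy_lt_top` for V, and Σ⁺ is the energy of V.

Finite energy: if p(Ñ₊-2) ≤ Ñ₊, then r^(Ñ₊-1) u' would tend to -∞ logarithmically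
(`add_one_lt_of_fastDecay`). Hence k < Ñ₊-2, and the integrand is O(|x|^(-s)) with s > N.

One inflection: u is decreasing, so u'' has the sign of K = -λ(N-1)u'/r - u^p. Let w = r^k u and G =
p r² u^(p-1) = p w^(p-1). At a zero of K, the derivative K' has the sign of G - λ(N-1), and if G ≤
λ(N-1) there then w' > 0 there. The Emden-Fowler curve (w, r w') has no self-intersection, by
scaling and ODE uniqueness, and w tends to 0 at both ends; a planar argument (`pos_of_pos_right`)
shows that w' > 0 at one radius forces w' > 0 at all smaller ones. So G increases up to any such
zero of K. This excludes G ≤ λ(N-1) at the first zero, where K therefore crosses upwards, and then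
excludes a second zero (`exists_unique_inflection`). -/

namespace PucciEnergy

/-! ### The scalar Pucci function and its inverse -/

/-- The inverse of the function `m ↦ Λ m⁺ - λ m⁻`. -/
noncomputable def pucciInv (lam Lam K : ℝ) : ℝ := min (K / lam) (K / Lam)

section pucciInv

variable {lam Lam : ℝ}

theorem pucciInv_of_nonpos (hlam : 0 < lam) (hLam : lam ≤ Lam) {K : ℝ} (hK : K ≤ 0) :
    pucciInv lam Lam K = K / lam := by
  refine min_eq_left ?_
  rw [div_le_div_iff₀ hlam (hlam.trans_le hLam)]
  nlinarith

theorem pucciInv_of_nonneg (hlam : 0 < lam) (hLam : lam ≤ Lam) {K : ℝ} (hK : 0 ≤ K) :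
    pucciInv lam Lam K = K / Lam :=
  min_eq_right (div_le_div_of_nonneg_left hK hlam hLam)

theorem pucciInv_pos_iff (hlam : 0 < lam) (hLam : lam ≤ Lam) {K : ℝ} :
    0 < pucciInv lam Lam K ↔ 0 < K := by
  have := hlam.trans_le hLam
  simp [pucciInv, hlam, this, div_pos_iff_of_pos_right]

theorem pucciInv_neg_iff (hlam : 0 < lam) (hLam : lam ≤ Lam) {K : ℝ} :
    pucciInv lam Lam K < 0 ↔ K < 0 := by
  have := hlam.trans_le hLam
  simp [pucciInv, hlam, this, div_neg_iff, hlam.le, this.le, not_lt.2]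

theorem pucciInv_mul {c : ℝ} (hc : 0 ≤ c) (K : ℝ) :
    pucciInv lam Lam (c * K) = c * pucciInv lam Lam K := by
  simp only [pucciInv, mul_div_assoc, mul_min_of_nonneg _ _ hc]

theorem pucciInv_sub_le (hlam : 0 < lam) (hLam : lam ≤ Lam) {a b : ℝ} (hab : a ≤ b) :
    pucciInv lam Lam b - pucciInv lam Lam a ≤ (b - a) / lam := by
  have hL := hlam.trans_le hLam
  rcases min_choice (a / lam) (a / Lam) with h | h
  · have := min_le_left (b / lam) (b / Lam)
    simp only [pucciInv, h, sub_div]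
    linarith
  · have h1 := min_le_right (b / lam) (b / Lam)
    have h2 : (b - a) / Lam ≤ (b - a) / lam :=
      div_le_div_of_nonneg_left (by linarith) hlam hLam
    simp only [pucciInv, h]
    rw [sub_div] at h2
    linarith

theorem pucciInv_mono (hlam : 0 < lam) (hLam : lam ≤ Lam) : Monotone (pucciInv lam Lam) := by
  intro a b hab
  have hL := hlam.trans_le hLam
  exact min_le_min (by gcongr) (by gcongr)

/-- A substitute for the mean value theorem, since the function has a corner at 0. That θ is
nonnegative, by monotonicity, keeps the sign of the friction term in the Grönwall estimate. -/
theorem exists_pucciInv_sub_eq (hlam : 0 < lam) (hLam : lam ≤ Lam) (a b : ℝ) :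
    ∃ θ : ℝ, 0 ≤ θ ∧ θ ≤ 1 / lam ∧
      pucciInv lam Lam a - pucciInv lam Lam b = θ * (a - b) := by
  wlog hab : b ≤ a generalizing a b
  · obtain ⟨θ, h0, h1, h2⟩ := this b a (le_of_not_ge hab)
    exact ⟨θ, h0, h1, by linarith⟩
  rcases hab.eq_or_lt with rfl | hlt
  · exact ⟨0, le_rfl, by positivity, by simp⟩
  have hpos : 0 < a - b := sub_pos.2 hlt
  refine ⟨(pucciInv lam Lam a - pucciInv lam Lam b) / (a - b), ?_, ?_, ?_⟩
  · exact div_nonneg (sub_nonneg.2 (pucciInv_mono hlam hLam hab)) hpos.le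
  · rw [div_le_iff₀ hpos]
    have := pucciInv_sub_le hlam hLam hab
    rwa [one_div_mul_eq_div]
  · field_simp

end pucciInv

/-! ### The radial ODE and its uniqueness properties -/

theorem abs_rpow_sub_rpow_le {p M x y : ℝ} (hp : 1 ≤ p) (hx : x ∈ Set.Icc 0 M)
    (hy : y ∈ Set.Icc 0 M) : |x ^ p - y ^ p| ≤ p * M ^ (p - 1) * |x - y| := by
  have := Convex.norm_image_sub_le_of_norm_hasDerivWithin_le (f := fun t : ℝ => t ^ p)
    (f' := fun t => p * t ^ (p - 1)) (s := Set.Icc 0 M) (C := p * M ^ (p - 1))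
    (fun t _ => (Real.hasDerivAt_rpow_const (Or.inr hp)).hasDerivWithinAt)
    (fun t ht => by
      rw [Real.norm_of_nonneg (mul_nonneg (by linarith) (Real.rpow_nonneg ht.1 _))]
      exact mul_le_mul_of_nonneg_left (Real.rpow_le_rpow ht.1 ht.2 (by linarith)) (by linarith))
    (convex_Icc 0 M) hy hx
  simpa [Real.norm_eq_abs] using this

/-- The quantity whose sign decides the convexity of the profile. -/
noncomputable def convexityTerm (lam n p : ℝ) (f g : ℝ → ℝ) (r : ℝ) : ℝ :=
  -(lam * n * g r / r) - f r ^ p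

/-- Positive decreasing solutions `f`, with `g = f'`, of the radial form of `-M⁺(D²u) = u^p` on
`(0, ∞)`, with `n = N - 1`. -/
structure ProfileODE (lam Lam n p : ℝ) (f g : ℝ → ℝ) : Prop where
  pos : ∀ r, 0 < r → 0 < f r
  neg : ∀ r, 0 < r → g r < 0
  hasDerivAt : ∀ r, 0 < r → HasDerivAt f (g r) r
  hasDerivAt_deriv : ∀ r, 0 < r →
    HasDerivAt g (pucciInv lam Lam (convexityTerm lam n p f g r)) r

/-- The squared distance of two solutions in the phase space. -/
def phaseDist (f₁ g₁ f₂ g₂ : ℝ → ℝ) (r : ℝ) : ℝ := (f₁ r - f₂ r) ^ 2 + (g₁ r - g₂ r) ^ 2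

/-- Here d and D are the differences of the values and of the slopes, Δ that of the powers. The
singular term -2θλnD²/r is nonpositive, so it drops out of the upper bound, which stays uniform as r
→ 0; only the lower bound pays 2n/r. -/
theorem phaseDist_deriv_bounds {lam n r L d D θ Δ : ℝ} (hlam : 0 < lam) (hn : 0 ≤ n)
    (hr : 0 < r) (hL : 0 ≤ L) (hθ : 0 ≤ θ) (hθ' : θ ≤ 1 / lam) (hΔ : |Δ| ≤ L * |d|) :
    2 * d * D + 2 * D * (θ * (-(lam * n * D / r) - Δ)) ≤ (L / lam + 1) * (d ^ 2 + D ^ 2) ∧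
    -((2 * n / r + L / lam + 1) * (d ^ 2 + D ^ 2)) ≤
      2 * d * D + 2 * D * (θ * (-(lam * n * D / r) - Δ)) := by
  have h1 : |2 * d * D| ≤ d ^ 2 + D ^ 2 := by
    rw [abs_le]; constructor <;> nlinarith [sq_nonneg (d - D), sq_nonneg (d + D)]
  have h2 : |2 * D * (θ * Δ)| ≤ L / lam * (d ^ 2 + D ^ 2) := by
    have : |2 * D * (θ * Δ)| = θ * |Δ| * (2 * |D|) := by
      rw [abs_mul, abs_mul, abs_mul, abs_of_nonneg hθ]; simp; ring
    rw [this]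
    have a1 : θ * |Δ| ≤ 1 / lam * (L * |d|) := by gcongr
    have a2 : θ * |Δ| * (2 * |D|) ≤ 1 / lam * (L * |d|) * (2 * |D|) := by gcongr
    have a3 : 2 * |d| * |D| ≤ d ^ 2 + D ^ 2 := by
      nlinarith [sq_nonneg (|d| - |D|), sq_abs d, sq_abs D]
    have a4 : L / lam * (2 * |d| * |D|) ≤ L / lam * (d ^ 2 + D ^ 2) := by gcongr
    calc _ ≤ _ := a2
      _ = L / lam * (2 * |d| * |D|) := by ring
      _ ≤ _ := a4
  have h3 : 0 ≤ θ * lam * (2 * n * D ^ 2 / r) := by positivity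
  have h4 : θ * lam * (2 * n * D ^ 2 / r) ≤ 2 * n / r * (d ^ 2 + D ^ 2) := by
    have : θ * lam ≤ 1 := by
      have := mul_le_mul_of_nonneg_right hθ' hlam.le
      rwa [one_div_mul_cancel hlam.ne'] at this
    calc _ ≤ 1 * (2 * n * D ^ 2 / r) := by gcongr
      _ = 2 * n / r * (0 + D ^ 2) := by ring
      _ ≤ _ := by gcongr; positivity
  have h5 : 2 * d * D + 2 * D * (θ * (-(lam * n * D / r) - Δ)) =
      2 * d * D - θ * lam * (2 * n * D ^ 2 / r) - 2 * D * (θ * Δ) := by ring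
  rw [h5]
  obtain ⟨b1, b2⟩ := abs_le.1 h1
  obtain ⟨c1, c2⟩ := abs_le.1 h2
  constructor <;> linarith

namespace ProfileODE

variable {lam Lam n p : ℝ} {f g f₁ g₁ f₂ g₂ : ℝ → ℝ}

theorem continuousAt (h : ProfileODE lam Lam n p f g) {r : ℝ} (hr : 0 < r) : ContinuousAt f r :=
  (h.hasDerivAt r hr).continuousAt

theorem continuousAt_deriv (h : ProfileODE lam Lam n p f g) {r : ℝ} (hr : 0 < r) :
    ContinuousAt g r :=
  (h.hasDerivAt_deriv r hr).continuousAt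

theorem strictAntiOn (h : ProfileODE lam Lam n p f g) : StrictAntiOn f (Set.Ioi 0) := by
  refine strictAntiOn_of_deriv_neg (convex_Ioi 0)
    (fun x hx => (h.continuousAt hx).continuousWithinAt) fun x hx => ?_
  rw [interior_Ioi] at hx
  rw [(h.hasDerivAt x hx).deriv]
  exact h.neg x hx

theorem phaseDist_hasDerivAt (hlam : 0 < lam) (hLam : lam ≤ Lam) (hn : 0 ≤ n) (hp : 1 ≤ p)
    (h₁ : ProfileODE lam Lam n p f₁ g₁) (h₂ : ProfileODE lam Lam n p f₂ g₂) {r M : ℝ}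
    (hr : 0 < r) (hM₁ : f₁ r ≤ M) (hM₂ : f₂ r ≤ M) :
    ∃ E, HasDerivAt (phaseDist f₁ g₁ f₂ g₂) E r ∧
      E ≤ (p * M ^ (p - 1) / lam + 1) * phaseDist f₁ g₁ f₂ g₂ r ∧
      -((2 * n / r + p * M ^ (p - 1) / lam + 1) * phaseDist f₁ g₁ f₂ g₂ r) ≤ E := by
  obtain ⟨θ, hθ, hθ', hθe⟩ := exists_pucciInv_sub_eq hlam hLam
    (convexityTerm lam n p f₁ g₁ r) (convexityTerm lam n p f₂ g₂ r)
  have hM : 0 ≤ M := (h₁.pos r hr).le.trans hM₁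
  have hb := phaseDist_deriv_bounds (D := g₁ r - g₂ r) (Δ := f₁ r ^ p - f₂ r ^ p) hlam hn hr
    (L := p * M ^ (p - 1)) (by positivity) hθ hθ'
    (abs_rpow_sub_rpow_le hp ⟨(h₁.pos r hr).le, hM₁⟩ ⟨(h₂.pos r hr).le, hM₂⟩)
  refine ⟨_, ?_, hb⟩
  have hd := ((h₁.hasDerivAt r hr).sub (h₂.hasDerivAt r hr)).pow 2 |>.add
    (((h₁.hasDerivAt_deriv r hr).sub (h₂.hasDerivAt_deriv r hr)).pow 2)
  refine hd.congr_deriv ?_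
  rw [hθe]
  simp only [convexityTerm, Pi.sub_apply]
  push_cast
  ring

/-- Grönwall started at the singular point: the distance times exp(-Cr) is nonincreasing and
vanishes at 0. As solutions decrease, the common initial value bounds both and fixes C. -/
theorem eq_of_eq_zero (hlam : 0 < lam) (hLam : lam ≤ Lam) (hn : 0 ≤ n) (hp : 1 ≤ p)
    (h₁ : ProfileODE lam Lam n p f₁ g₁) (h₂ : ProfileODE lam Lam n p f₂ g₂)
    (cf₁ : ContinuousOn f₁ (Set.Ici 0)) (cg₁ : ContinuousOn g₁ (Set.Ici 0))
    (cf₂ : ContinuousOn f₂ (Set.Ici 0)) (cg₂ : ContinuousOn g₂ (Set.Ici 0))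
    (hf : f₁ 0 = f₂ 0) (hg : g₁ 0 = g₂ 0) {r : ℝ} (hr : 0 ≤ r) : f₁ r = f₂ r := by
  have anti : ∀ {f g}, ProfileODE lam Lam n p f g → ContinuousOn f (Set.Ici 0) →
      AntitoneOn f (Set.Ici 0) := by
    intro f g h c
    refine antitoneOn_of_deriv_nonpos (convex_Ici 0) c ?_ ?_ <;> rw [interior_Ici]
    · exact fun x hx => (h.hasDerivAt x hx).differentiableAt.differentiableWithinAt
    · intro x hx
      rw [(h.hasDerivAt x hx).deriv]
      exact (h.neg x hx).le
  set C := p * f₁ 0 ^ (p - 1) / lam + 1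
  set e := phaseDist f₁ g₁ f₂ g₂ with he
  have hD : ∀ x, 0 < x → ∃ E, HasDerivAt (fun r => e r * Real.exp (-(C * r))) E x ∧ E ≤ 0 := by
    intro x hx
    obtain ⟨E, hE, hE', -⟩ := phaseDist_hasDerivAt hlam hLam hn hp h₁ h₂ hx (M := f₁ 0)
      (anti h₁ cf₁ (Set.self_mem_Ici) hx.le hx.le)
      (hf ▸ anti h₂ cf₂ (Set.self_mem_Ici) hx.le hx.le)
    have hexp : HasDerivAt (fun r => Real.exp (-(C * r))) (Real.exp (-(C * x)) * -(C * 1)) x :=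
      ((hasDerivAt_id x).const_mul C).neg.exp
    refine ⟨_, hE.mul hexp, ?_⟩
    have : E * Real.exp (-(C * x)) + e x * (Real.exp (-(C * x)) * -(C * 1)) =
      (E - C * e x) * Real.exp (-(C * x)) := by ring
    rw [this]
    exact mul_nonpos_of_nonpos_of_nonneg (by linarith) (Real.exp_nonneg _)
  have ha : AntitoneOn (fun r => e r * Real.exp (-(C * r))) (Set.Ici 0) := by
    refine antitoneOn_of_deriv_nonpos (convex_Ici 0) ?_ ?_ ?_
    · exact (((cf₁.sub cf₂).pow 2).add ((cg₁.sub cg₂).pow 2)).mul (by fun_prop)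
    · rw [interior_Ici]
      intro x hx
      obtain ⟨E, hE, -⟩ := hD x hx
      exact hE.differentiableAt.differentiableWithinAt
    · rw [interior_Ici]
      intro x hx
      obtain ⟨E, hE, hE'⟩ := hD x hx
      rwa [hE.deriv]
  have h0 := ha Set.self_mem_Ici hr hr
  have e0 : e 0 = 0 := by simp [he, phaseDist, hf, hg]
  simp only [e0, zero_mul] at h0
  have h1 : e r ≤ 0 := nonpos_of_mul_nonpos_left h0 (Real.exp_pos _)
  simp only [he, phaseDist] at h1
  have : (f₁ r - f₂ r) ^ 2 = 0 := le_antisymm (by nlinarith [sq_nonneg (g₁ r - g₂ r)]) (sq_nonneg _)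
  exact sub_eq_zero.1 (pow_eq_zero_iff two_ne_zero |>.1 this)

/-- Grönwall backwards from b, on radii at least a > 0, where the singular coefficient 2n/r is at
most 2n/a. -/
theorem eq_of_eq_right (hlam : 0 < lam) (hLam : lam ≤ Lam) (hn : 0 ≤ n) (hp : 1 ≤ p)
    (h₁ : ProfileODE lam Lam n p f₁ g₁) (h₂ : ProfileODE lam Lam n p f₂ g₂) {b : ℝ}
    (hf : f₁ b = f₂ b) (hg : g₁ b = g₂ b) {a : ℝ} (ha : 0 < a) (hab : a ≤ b) :
    f₁ a = f₂ a := by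
  set M := max (f₁ a) (f₂ a)
  set C := 2 * n / a + p * M ^ (p - 1) / lam + 1
  set e := phaseDist f₁ g₁ f₂ g₂ with he
  have hD : ∀ x, a ≤ x → ∃ E, HasDerivAt (fun r => e r * Real.exp (C * r)) E x ∧ 0 ≤ E := by
    intro x hx
    have hx0 := ha.trans_le hx
    obtain ⟨E, hE, -, hE'⟩ := phaseDist_hasDerivAt hlam hLam hn hp h₁ h₂ hx0 (M := M)
      ((h₁.strictAntiOn.antitoneOn ha hx0 hx).trans (le_max_left _ _))
      ((h₂.strictAntiOn.antitoneOn ha hx0 hx).trans (le_max_right _ _))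
    have hexp : HasDerivAt (fun r => Real.exp (C * r)) (Real.exp (C * x) * (C * 1)) x :=
      ((hasDerivAt_id x).const_mul C).exp
    refine ⟨_, hE.mul hexp, ?_⟩
    have : E * Real.exp (C * x) + e x * (Real.exp (C * x) * (C * 1)) =
      (E + C * e x) * Real.exp (C * x) := by ring
    rw [this]
    refine mul_nonneg ?_ (Real.exp_nonneg _)
    have he0 : 0 ≤ e x := add_nonneg (sq_nonneg _) (sq_nonneg _)
    have : 2 * n / x ≤ 2 * n / a := by gcongr
    have : (2 * n / x + p * M ^ (p - 1) / lam + 1) * e x ≤ C * e x :=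
      mul_le_mul_of_nonneg_right (by simp only [C]; linarith) he0
    linarith
  have ha' : MonotoneOn (fun r => e r * Real.exp (C * r)) (Set.Ici a) := by
    refine monotoneOn_of_deriv_nonneg (convex_Ici a) ?_ ?_ ?_
    · intro x hx
      obtain ⟨E, hE, -⟩ := hD x hx
      exact hE.continuousAt.continuousWithinAt
    · rw [interior_Ici]
      intro x hx
      obtain ⟨E, hE, -⟩ := hD x (Set.mem_Ioi.1 hx).le
      exact hE.differentiableAt.differentiableWithinAt
    · rw [interior_Ici]
      intro x hx
      obtain ⟨E, hE, hE'⟩ := hD x (Set.mem_Ioi.1 hx).le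
      rwa [hE.deriv]
  have h0 := ha' Set.self_mem_Ici hab hab
  have e0 : e b = 0 := by simp [he, phaseDist, hf, hg]
  simp only [e0, zero_mul] at h0
  have h1 : e a ≤ 0 := nonpos_of_mul_nonpos_left h0 (Real.exp_pos _)
  simp only [he, phaseDist] at h1
  have : (f₁ a - f₂ a) ^ 2 = 0 := le_antisymm (by nlinarith [sq_nonneg (g₁ a - g₂ a)]) (sq_nonneg _)
  exact sub_eq_zero.1 (pow_eq_zero_iff two_ne_zero |>.1 this)

end ProfileODE

/-! ### First zeros and a planar curve argument -/

section realFunctions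

/-- Serves to parametrise a monotone arc of the curve by w. Continuity of the inverse comes from
compactness. -/
theorem exists_continuousOn_leftInvOn {f : ℝ → ℝ} {K : Set ℝ} (hK : IsCompact K)
    (hf : ContinuousOn f K) (hinj : Set.InjOn f K) :
    ∃ g : ℝ → ℝ, ContinuousOn g (f '' K) ∧ Set.LeftInvOn g f K := by
  have hl : Set.LeftInvOn (Function.invFunOn f K) f K := hinj.leftInvOn_invFunOn
  refine ⟨Function.invFunOn f K, ?_, hl⟩
  rw [continuousOn_iff_isClosed]
  intro t ht
  refine ⟨f '' (K ∩ t), ((hK.inter_right ht).image_of_continuousOn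
    (hf.mono Set.inter_subset_left)).isClosed, ?_⟩
  ext y
  constructor
  · rintro ⟨hy, x, hx, rfl⟩
    rw [Set.mem_preimage, hl hx] at hy
    exact ⟨⟨x, ⟨hx, hy⟩, rfl⟩, x, hx, rfl⟩
  · rintro ⟨⟨x, ⟨hx, hxt⟩, rfl⟩, h⟩
    refine ⟨?_, h⟩
    rwa [Set.mem_preimage, hl hx]

theorem exists_first_zero {F : ℝ → ℝ} {a b : ℝ} (hab : a ≤ b) (hF : ContinuousOn F (Set.Icc a b))
    (ha : 0 < F a) (hb : F b ≤ 0) :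
    ∃ c, a < c ∧ c ≤ b ∧ F c = 0 ∧ ∀ x, a ≤ x → x < c → 0 < F x := by
  set Z := Set.Icc a b ∩ F ⁻¹' Set.Iic 0
  have hZc : IsClosed Z := hF.preimage_isClosed_of_isClosed isClosed_Icc isClosed_Iic
  have hbd : BddBelow Z := ⟨a, fun x hx => hx.1.1⟩
  have hm : sInf Z ∈ Z := hZc.csInf_mem ⟨b, ⟨hab, le_rfl⟩, hb⟩ hbd
  set c := sInf Z
  have hpos : ∀ x, a ≤ x → x < c → 0 < F x := fun x hx hxc => by
    by_contra hcon
    exact not_le.2 hxc (csInf_le hbd ⟨⟨hx, hxc.le.trans hm.1.2⟩, not_lt.1 hcon⟩)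
  have hFc : F c ≤ 0 := hm.2
  have hac : a < c := lt_of_le_of_ne hm.1.1 fun h => by rw [← h] at hFc; linarith
  refine ⟨c, hac, hm.1.2, le_antisymm hFc ?_, hpos⟩
  obtain ⟨x, hx, hx0⟩ := intermediate_value_Icc' hac.le
    (hF.mono (Set.Icc_subset_Icc_right hm.1.2)) ⟨hFc, ha.le⟩
  rcases hx.2.eq_or_lt with h | h
  · rw [← h, hx0]
  · exact absurd hx0 (hpos x hx.1 h).ne'

theorem eventually_pos_right {F : ℝ → ℝ} {d x : ℝ} (h : HasDerivAt F d x) (hx : F x = 0)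
    (hd : 0 < d) : ∀ᶠ y in 𝓝[>] x, 0 < F y := by
  have hs := (hasDerivAt_iff_tendsto_slope.1 h).eventually_const_lt hd
  filter_upwards [hs.filter_mono (nhdsWithin_mono x fun y hy => ne_of_gt hy),
    self_mem_nhdsWithin] with y hy hy'
  rw [slope_def_field, hx, sub_zero] at hy
  exact (div_pos_iff_of_pos_right (sub_pos.2 hy')).1 hy

theorem eventually_neg_left {F : ℝ → ℝ} {d x : ℝ} (h : HasDerivAt F d x) (hx : F x = 0)
    (hd : 0 < d) : ∀ᶠ y in 𝓝[<] x, F y < 0 := by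
  have hs := (hasDerivAt_iff_tendsto_slope.1 h).eventually_const_lt hd
  filter_upwards [hs.filter_mono (nhdsWithin_mono x fun y hy => ne_of_lt hy),
    self_mem_nhdsWithin] with y hy hy'
  rw [slope_def_field, hx, sub_zero] at hy
  have hy'' : y < x := hy'
  rcases div_pos_iff.1 hy with h | h <;> linarith [h.1, h.2]

theorem deriv_nonpos_of_pos_left {F : ℝ → ℝ} {a d x : ℝ} (h : HasDerivAt F d x) (hx : F x = 0)
    (hax : a < x) (hF : ∀ y, a < y → y < x → 0 < F y) : d ≤ 0 := by
  by_contra hd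
  have h1 := eventually_neg_left h hx (not_le.1 hd)
  have h2 : Set.Ioo a x ∈ 𝓝[<] x := Ioo_mem_nhdsLT hax
  obtain ⟨y, hy, hy'⟩ := (h1.and h2).exists
  linarith [hF y hy'.1 hy'.2]

theorem exists_right_of_eventually {P : ℝ → Prop} {x b : ℝ} (h : ∀ᶠ y in 𝓝[>] x, P y)
    (hb : x < b) : ∃ c, x < c ∧ c < b ∧ ∀ y, x < y → y ≤ c → P y := by
  obtain ⟨u, hu, hu'⟩ := mem_nhdsGT_iff_exists_Ioo_subset.1 h
  have hu : x < u := hu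
  refine ⟨(x + min u b) / 2, ?_, ?_, fun y hy hy' => hu' ⟨hy, ?_⟩⟩ <;>
    have := lt_min hu hb <;> have := min_le_left u b <;> have := min_le_right u b <;> linarith

theorem strictMonoOn_of_hasDerivAt_pos {F F' : ℝ → ℝ} {D : Set ℝ} (hD : Convex ℝ D)
    (hc : ContinuousOn F D) (h : ∀ x ∈ interior D, HasDerivAt F (F' x) x ∧ 0 < F' x) :
    StrictMonoOn F D :=
  strictMonoOn_of_deriv_pos hD hc fun x hx => by rw [(h x hx).1.deriv]; exact (h x hx).2

theorem strictAntiOn_of_hasDerivAt_neg {F F' : ℝ → ℝ} {D : Set ℝ} (hD : Convex ℝ D)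
    (hc : ContinuousOn F D) (h : ∀ x ∈ interior D, HasDerivAt F (F' x) x ∧ F' x < 0) :
    StrictAntiOn F D :=
  strictAntiOn_of_deriv_neg hD hc fun x hx => by rw [(h x hx).1.deriv]; exact (h x hx).2

/-- A planar curve `(w, v)` without self-intersections on which `w` increases exactly where `v > 0`,
and which comes from and goes to `w = 0`, has a single arc in `v > 0`. -/
theorem pos_of_pos_right {w v v' : ℝ → ℝ} (hw : ∀ r, 0 < r → HasDerivAt w (v r / r) r)
    (hv : ∀ r, 0 < r → HasDerivAt v (v' r) r) (hnd : ∀ r, 0 < r → v r = 0 → v' r ≠ 0)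
    (hinj : ∀ s t, 0 < s → s < t → w s = w t → v s ≠ v t) (hpos : ∀ r, 0 < r → 0 < w r)
    (hw0 : Tendsto w (𝓝[>] 0) (𝓝 0)) (hwi : Tendsto w atTop (𝓝 0))
    (hv0 : ∀ᶠ r in 𝓝[>] 0, 0 < v r) {a b : ℝ} (ha : 0 < a) (hab : a ≤ b) (hb : 0 < v b) :
    0 < v a := by
  by_contra hva
  have hva := not_lt.1 hva
  have cw : ∀ {s : Set ℝ}, s ⊆ Set.Ioi 0 → ContinuousOn w s :=
    fun hs x hx => (hw x (hs hx)).continuousAt.continuousWithinAt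
  have cv : ∀ {s : Set ℝ}, s ⊆ Set.Ioi 0 → ContinuousOn v s :=
    fun hs x hx => (hv x (hs hx)).continuousAt.continuousWithinAt
  have sub : ∀ {x y : ℝ}, 0 < x → Set.Icc x y ⊆ Set.Ioi 0 := fun hx z hz => hx.trans_le hz.1
  -- the first arc, up to the maximum at `r₁`
  obtain ⟨a₀, ha₀, ha₀a, hva₀⟩ := exists_right_of_eventually hv0 ha
  obtain ⟨r₁, hr₁, hr₁a, hvr₁, hvpos⟩ := exists_first_zero ha₀a.le (cv (sub ha₀))
    (hva₀ a₀ ha₀ le_rfl) hva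
  have hr₁0 : 0 < r₁ := ha₀.trans hr₁
  have up : ∀ r, 0 < r → r < r₁ → 0 < v r := fun r h0 h1 => by
    rcases le_total r a₀ with h | h
    · exact hva₀ r h0 h
    · exact hvpos r h h1
  -- Nondegeneracy of the zeros of v makes v really change sign here, and again at `t₂`.
  have hv'1 : v' r₁ < 0 := lt_of_le_of_ne
    (deriv_nonpos_of_pos_left (hv r₁ hr₁0) hvr₁ hr₁0 up) (hnd r₁ hr₁0 hvr₁)
  have hr₁b : r₁ < b := lt_of_le_of_ne (hr₁a.trans hab) fun h => by rw [h] at hvr₁; linarith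
  -- the second arc, down to the minimum at `t₂`
  obtain ⟨c, hc, hcb, hvc⟩ := exists_right_of_eventually
    (eventually_pos_right (F := fun r => -v r) (hv r₁ hr₁0).neg (by simp [hvr₁])
      (by linarith)) hr₁b
  have hc0 := hr₁0.trans hc
  obtain ⟨t₂, hct₂, ht₂b, hvt₂, hvneg⟩ := exists_first_zero (F := fun r => -v r) hcb.le
    (cv (sub hc0)).neg (hvc c hc le_rfl) (by linarith)
  have hvt₂ : v t₂ = 0 := neg_eq_zero.1 hvt₂
  have hr₁t₂ := hc.trans hct₂
  have ht₂0 : 0 < t₂ := hr₁0.trans hr₁t₂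
  have down : ∀ r, r₁ < r → r < t₂ → 0 < -v r := fun r h0 h1 => by
    rcases le_total r c with h | h
    · exact hvc r h0 h
    · exact hvneg r h h1
  have hv'2 : 0 < v' t₂ := by
    have := deriv_nonpos_of_pos_left (hv t₂ ht₂0).neg (by simp [hvt₂]) hr₁t₂ down
    exact lt_of_le_of_ne (by linarith) (hnd t₂ ht₂0 hvt₂).symm
  have mono₁ : ∀ s, 0 < s → StrictMonoOn w (Set.Icc s r₁) := fun s hs => by
    refine strictMonoOn_of_hasDerivAt_pos (F' := fun r => v r / r) (convex_Icc _ _) (cw (sub hs)) fun x hx => ?_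
    rw [interior_Icc] at hx
    have hx0 := hs.trans hx.1
    exact ⟨hw x hx0, div_pos (up x hx0 hx.2) hx0⟩
  have anti₂ : StrictAntiOn w (Set.Icc r₁ t₂) := by
    refine strictAntiOn_of_hasDerivAt_neg (F' := fun r => v r / r) (convex_Icc _ _) (cw (sub hr₁0)) fun x hx => ?_
    rw [interior_Icc] at hx
    have hx0 := hr₁0.trans hx.1
    exact ⟨hw x hx0, div_neg_of_neg_of_pos (neg_pos.1 (down x hx.1 hx.2)) hx0⟩
  have hmM : w t₂ < w r₁ := anti₂ ⟨le_rfl, hr₁t₂.le⟩ ⟨hr₁t₂.le, le_rfl⟩ hr₁t₂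
  -- The point of the first arc at the level of the minimum; it exists because w starts from 0.
  obtain ⟨s, hs0, hsr₁, hws⟩ : ∃ s, 0 < s ∧ s < r₁ ∧ w s = w t₂ := by
    obtain ⟨s₀, hs₀, hs₀r, hs₀w⟩ := exists_right_of_eventually
      (hw0.eventually_lt_const (hpos t₂ ht₂0)) hr₁0
    obtain ⟨s, hs, hsw⟩ := intermediate_value_Icc hs₀r.le (cw (sub hs₀))
      ⟨(hs₀w s₀ hs₀ le_rfl).le, hmM.le⟩
    refine ⟨s, hs₀.trans_le hs.1, lt_of_le_of_ne hs.2 ?_, hsw⟩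
    rintro rfl
    linarith
  obtain ⟨τ₁, cτ₁, hτ₁⟩ := exists_continuousOn_leftInvOn isCompact_Icc (cw (sub hs0))
    (mono₁ s hs0).injOn
  obtain ⟨τ₂, cτ₂, hτ₂⟩ := exists_continuousOn_leftInvOn isCompact_Icc (cw (sub hr₁0))
    anti₂.injOn
  have im₁ : Set.Icc (w t₂) (w r₁) ⊆ w '' Set.Icc s r₁ := by
    rw [← hws]
    exact intermediate_value_Icc hsr₁.le (cw (sub hs0))
  have im₂ : Set.Icc (w t₂) (w r₁) ⊆ w '' Set.Icc r₁ t₂ :=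
    intermediate_value_Icc' hr₁t₂.le (cw (sub hr₁0))
  -- the way up from `t₂` and the first return to the level `w t₂`
  have hlt : ∀ᶠ y in 𝓝[>] t₂, w y < w r₁ :=
    ((hw t₂ ht₂0).continuousAt.eventually_lt_const hmM).filter_mono nhdsWithin_le_nhds
  obtain ⟨c₂, hc₂, -, hvc₂⟩ := exists_right_of_eventually
    ((eventually_pos_right (hv t₂ ht₂0) hvt₂ hv'2).and hlt) (lt_add_one t₂)
  have hc₂0 := ht₂0.trans hc₂
  have mono₃ : StrictMonoOn w (Set.Icc t₂ c₂) := by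
    refine strictMonoOn_of_hasDerivAt_pos (F' := fun r => v r / r) (convex_Icc _ _) (cw (sub ht₂0)) fun x hx => ?_
    rw [interior_Icc] at hx
    have hx0 := ht₂0.trans hx.1
    exact ⟨hw x hx0, div_pos (hvc₂ x hx.1 hx.2.le).1 hx0⟩
  obtain ⟨T, hTw, hT⟩ :=
    ((hwi.eventually_lt_const (hpos t₂ ht₂0)).and (eventually_ge_atTop c₂)).exists
  obtain ⟨e, hce, -, hwe, hwm⟩ := exists_first_zero (F := fun r => w r - w t₂) hT
    ((cw (sub hc₂0)).sub continuousOn_const)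
    (sub_pos.2 (mono₃ ⟨le_rfl, hc₂.le⟩ ⟨hc₂.le, le_rfl⟩ hc₂)) (by linarith)
  have he0 := hc₂0.trans hce
  have hwe : w e = w t₂ := sub_eq_zero.1 hwe
  -- A first return to the level from above gives v ≤ 0; equality would put the curve back on its
  -- point at `t₂`.
  have hve : v e < 0 := by
    have h1 := deriv_nonpos_of_pos_left ((hw e he0).sub_const (w t₂)) (by simp [hwe]) hce
      fun y hy hy' => hwm y hy.le hy'
    refine lt_of_le_of_ne ?_ fun h =>
      hinj t₂ e ht₂0 (hc₂.trans hce) hwe.symm (by rw [hvt₂, h])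
    by_contra hcon
    exact absurd (div_pos (not_le.1 hcon) he0) (not_lt.2 h1)
  have low : ∀ x, t₂ ≤ x → x ≤ e → w t₂ ≤ w x := fun x h1 h2 => by
    rcases le_total x c₂ with h | h
    · exact mono₃.monotoneOn ⟨le_rfl, hc₂.le⟩ ⟨h1, h⟩ h1
    · rcases h2.eq_or_lt with rfl | h2
      · exact hwe.ge
      · linarith [hwm x h h2]
  by_cases hbig : ∃ x, c₂ ≤ x ∧ x ≤ e ∧ w r₁ ≤ w x
  · -- crossing of the first arc
    obtain ⟨x, hx, hxe, hwx⟩ := hbig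
    obtain ⟨t, ht, htx, hwt, hwlt⟩ := exists_first_zero (F := fun r => w r₁ - w r) hx
      (continuousOn_const.sub (cw (sub hc₂0))) (sub_pos.2 (hvc₂ c₂ hc₂ le_rfl).2) (by linarith)
    have ht0 := hc₂0.trans ht
    have hwt : w r₁ = w t := sub_eq_zero.1 hwt
    have hvt : 0 < v t := by
      have h1 := deriv_nonpos_of_pos_left ((hw t ht0).const_sub (w r₁)) (by simp [hwt]) ht
        fun y hy hy' => hwlt y hy.le hy'
      refine lt_of_le_of_ne ?_ fun h =>
        hinj r₁ t hr₁0 (hr₁t₂.trans (hc₂.trans ht)) hwt (by rw [hvr₁, h])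
      by_contra hcon
      have := div_neg_of_neg_of_pos (not_le.1 hcon) ht0
      linarith
    have hmem : Set.MapsTo w (Set.Icc t₂ t) (Set.Icc (w t₂) (w r₁)) := fun y hy => by
      refine ⟨low y hy.1 (hy.2.trans (htx.trans hxe)), ?_⟩
      rcases le_total y c₂ with h | h
      · rcases hy.1.eq_or_lt with rfl | h'
        · exact hmM.le
        · exact (hvc₂ y h' h).2.le
      · rcases hy.2.eq_or_lt with rfl | h'
        · exact hwt.ge
        · linarith [hwlt y h h']
    -- Vertical gap between the first arc and the later curve over the same w: positive at `t₂`,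
    -- negative at `t`, so it vanishes and the curve meets itself.
    have cB : ContinuousOn (fun y => v (τ₁ (w y)) - v y) (Set.Icc t₂ t) := by
      refine ContinuousOn.sub ?_ (cv (sub ht₂0))
      refine (cv (sub hs0)).comp (t := Set.Icc s r₁)
        (cτ₁.comp (cw (sub ht₂0)) fun y hy => im₁ (hmem hy)) fun y hy => ?_
      obtain ⟨z, hz, hzw⟩ := im₁ (hmem hy)
      rwa [← hzw, hτ₁ hz]
    have e1 : τ₁ (w t) = r₁ := by rw [← hwt, hτ₁ ⟨hsr₁.le, le_rfl⟩]
    have e2 : τ₁ (w t₂) = s := by rw [← hws, hτ₁ ⟨le_rfl, hsr₁.le⟩]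
    obtain ⟨y, hy, hy0⟩ := intermediate_value_Icc' (hc₂.trans ht).le cB
      (show (0 : ℝ) ∈ Set.Icc _ _ from ⟨by simp only [e1, hvr₁]; linarith,
        by simp only [e2, hvt₂]; linarith [up s hs0 hsr₁]⟩)
    obtain ⟨z, hz, hzw⟩ := im₁ (hmem hy)
    refine hinj z y (hs0.trans_le hz.1) ((hz.2.trans_lt hr₁t₂).trans_le hy.1) hzw ?_
    have : τ₁ (w y) = z := by rw [← hzw, hτ₁ hz]
    simp only [this] at hy0
    linarith
  · -- crossing of the second arc
    push Not at hbig
    have hmem : Set.MapsTo w (Set.Icc c₂ e) (Set.Icc (w t₂) (w r₁)) := fun y hy =>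
      ⟨low y (hc₂.le.trans hy.1) hy.2, (hbig y hy.1 hy.2).le⟩
    have hmemτ : ∀ y ∈ Set.Icc c₂ e, τ₂ (w y) ∈ Set.Icc r₁ t₂ := fun y hy => by
      obtain ⟨z, hz, hzw⟩ := im₂ (hmem hy)
      rwa [← hzw, hτ₂ hz]
    -- Vertical gap between the later curve and the second arc: positive at `c₂`, negative at `e`,
    -- again a self-intersection.
    have cA : ContinuousOn (fun y => v y - v (τ₂ (w y))) (Set.Icc c₂ e) := by
      refine (cv (sub hc₂0)).sub ?_
      exact (cv (sub hr₁0)).comp (t := Set.Icc r₁ t₂)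
        (cτ₂.comp (cw (sub hc₂0)) fun y hy => im₂ (hmem hy)) hmemτ
    have e1 : τ₂ (w e) = t₂ := by rw [hwe, hτ₂ ⟨hr₁t₂.le, le_rfl⟩]
    have e2 : v (τ₂ (w c₂)) ≤ 0 := by
      obtain ⟨h1, h2⟩ := hmemτ c₂ ⟨le_rfl, hce.le⟩
      rcases h1.eq_or_lt with h | h
      · rw [← h, hvr₁]
      · rcases h2.eq_or_lt with h' | h'
        · rw [h', hvt₂]
        · linarith [down _ h h']
    obtain ⟨y, hy, hy0⟩ := intermediate_value_Icc' hce.le cA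
      (show (0 : ℝ) ∈ Set.Icc _ _ from ⟨by simp only [e1, hvt₂]; linarith,
        by linarith [(hvc₂ c₂ hc₂ le_rfl).1]⟩)
    obtain ⟨z, hz, hzw⟩ := im₂ (hmem hy)
    refine hinj z y (hr₁0.trans_le hz.1) ((hz.2.trans_lt hc₂).trans_le hy.1) hzw ?_
    have : τ₂ (w y) = z := by rw [← hzw, hτ₂ hz]
    simp only [this] at hy0
    linarith

end realFunctions

/-! ### Scaling and the Emden-Fowler curve -/

namespace ProfileODE

variable {lam Lam n p k : ℝ} {f g : ℝ → ℝ}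

/-- The condition on k says k = 2/(p-1) (when p ≠ 1): both terms of `convexityTerm` then scale by
ρ^(k+2), and `pucciInv` is positively homogeneous. -/
theorem rescale (hk : k + 2 = k * p) (h : ProfileODE lam Lam n p f g) {ρ : ℝ} (hρ : 0 < ρ) :
    ProfileODE lam Lam n p (fun r => ρ ^ k * f (ρ * r)) (fun r => ρ ^ (k + 1) * g (ρ * r)) where
  pos r hr := mul_pos (Real.rpow_pos_of_pos hρ _) (h.pos _ (mul_pos hρ hr))
  neg r hr := mul_neg_of_pos_of_neg (Real.rpow_pos_of_pos hρ _) (h.neg _ (mul_pos hρ hr))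
  hasDerivAt r hr := by
    have h1 : HasDerivAt (fun r => ρ * r) (ρ * 1) r := (hasDerivAt_id r).const_mul ρ
    refine (((h.hasDerivAt _ (mul_pos hρ hr)).comp r h1).const_mul (ρ ^ k)).congr_deriv ?_
    rw [Real.rpow_add_one hρ.ne']
    ring
  hasDerivAt_deriv r hr := by
    have h1 : HasDerivAt (fun r => ρ * r) (ρ * 1) r := (hasDerivAt_id r).const_mul ρ
    refine (((h.hasDerivAt_deriv _ (mul_pos hρ hr)).comp r h1).const_mul
      (ρ ^ (k + 1))).congr_deriv ?_
    have e1 : ρ ^ (k + 2) = ρ ^ (k + 1) * ρ := by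
      rw [← Real.rpow_add_one hρ.ne']; ring_nf
    have e2 : (ρ ^ k * f (ρ * r)) ^ p = ρ ^ (k + 2) * f (ρ * r) ^ p := by
      rw [Real.mul_rpow (Real.rpow_nonneg hρ.le _) (h.pos _ (mul_pos hρ hr)).le,
        ← Real.rpow_mul hρ.le, hk]
    have e3 : convexityTerm lam n p (fun r => ρ ^ k * f (ρ * r))
        (fun r => ρ ^ (k + 1) * g (ρ * r)) r =
        ρ ^ (k + 2) * convexityTerm lam n p f g (ρ * r) := by
      simp only [convexityTerm]
      rw [e2, e1]
      field_simp
    rw [e3, pucciInv_mul (Real.rpow_nonneg hρ.le _), e1]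
    ring

theorem tendsto_rpow_mul_zero (hk : 0 < k) {A : ℝ} (hf : Tendsto f (𝓝[>] 0) (𝓝 A)) :
    Tendsto (fun r => r ^ k * f r) (𝓝[>] 0) (𝓝 0) := by
  have h1 : Tendsto (fun r : ℝ => r ^ k) (𝓝[>] 0) (𝓝 0) := by
    have := (Real.continuousAt_rpow_const 0 k (Or.inr hk.le)).tendsto
    rw [Real.zero_rpow hk.ne'] at this
    exact this.mono_left nhdsWithin_le_nhds
  simpa using h1.mul hf

/-- The Emden-Fowler curve of a solution which is regular at the origin does not meet itself. -/
theorem fowler_injective (hlam : 0 < lam) (hLam : lam ≤ Lam) (hn : 0 ≤ n) (hp : 1 ≤ p)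
    (hk0 : 0 < k) (hk : k + 2 = k * p) (h : ProfileODE lam Lam n p f g) {A : ℝ} (hA : 0 < A)
    (hf : Tendsto f (𝓝[>] 0) (𝓝 A)) {s t : ℝ} (hs : 0 < s) (hst : s < t)
    (hw : s ^ k * f s = t ^ k * f t) : s ^ (k + 1) * g s ≠ t ^ (k + 1) * g t := by
  intro hz
  have ht := hs.trans hst
  set ρ := t / s
  have hρ1 : 1 < ρ := (one_lt_div hs).2 hst
  have hρ : 0 < ρ := one_pos.trans hρ1
  have hρs : ρ * s = t := div_mul_cancel₀ _ hs.ne'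
  have h2 := h.rescale hk hρ
  have ef : f s = ρ ^ k * f (ρ * s) := by
    rw [hρs, Real.div_rpow ht.le hs.le, div_mul_eq_mul_div, ← hw, mul_comm,
      mul_div_cancel_right₀ _ (Real.rpow_pos_of_pos hs _).ne']
  have eg : g s = ρ ^ (k + 1) * g (ρ * s) := by
    rw [hρs, Real.div_rpow ht.le hs.le, div_mul_eq_mul_div, ← hz, mul_comm,
      mul_div_cancel_right₀ _ (Real.rpow_pos_of_pos hs _).ne']
  -- A self-intersection means that f and its rescaling by ρ share value and slope at s, hence agree
  -- on (0, s]. Letting a → 0 gives A = ρ^k A, impossible for ρ > 1.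
  have key : ∀ᶠ a in 𝓝[>] 0, f a = ρ ^ k * f (ρ * a) := by
    filter_upwards [Ioo_mem_nhdsGT hs] with a ha
    exact eq_of_eq_right hlam hLam hn hp h h2 ef eg ha.1 ha.2.le
  have hmul : Tendsto (fun a => ρ * a) (𝓝[>] 0) (𝓝[>] 0) := by
    refine tendsto_nhdsWithin_iff.2 ⟨?_, ?_⟩
    · have : Tendsto (fun a => ρ * a) (𝓝 0) (𝓝 (ρ * 0)) := by
        exact (continuous_const_mul ρ).tendsto 0
      rw [mul_zero] at this
      exact this.mono_left nhdsWithin_le_nhds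
    · filter_upwards [self_mem_nhdsWithin] with a ha
      exact mul_pos hρ ha
  have lim := tendsto_nhds_unique (hf.congr' key) ((hf.comp hmul).const_mul (ρ ^ k))
  have : 1 < ρ ^ k := Real.one_lt_rpow hρ1 hk0
  nlinarith

/-- These are the singular solutions, for which r^k f is constant; `hA` is the equation for that
constant. -/
theorem of_rpow (hk0 : 0 < k) (hk : k + 2 = k * p) {C : ℝ}
    (hC : 0 < C) (hA : pucciInv lam Lam (lam * n * k * C - C ^ p) = k * (k + 1) * C) :
    ProfileODE lam Lam n p (fun r => C * r ^ (-k)) (fun r => -(k * C * r ^ (-k - 1))) where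
  pos r hr := mul_pos hC (Real.rpow_pos_of_pos hr _)
  neg r hr := neg_neg_of_pos (mul_pos (mul_pos hk0 hC) (Real.rpow_pos_of_pos hr _))
  hasDerivAt r hr := by
    refine ((Real.hasDerivAt_rpow_const (p := -k) (Or.inl hr.ne')).const_mul C).congr_deriv ?_
    ring
  hasDerivAt_deriv r hr := by
    have := ((Real.hasDerivAt_rpow_const (p := -k - 1) (Or.inl hr.ne')).const_mul (k * C)).neg
    refine this.congr_deriv ?_
    have e1 : r ^ (-k - 1) = r ^ (-k - 1 - 1) * r := by
      rw [← Real.rpow_add_one hr.ne']; ring_nf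
    have e2 : (C * r ^ (-k)) ^ p = r ^ (-k - 1 - 1) * C ^ p := by
      rw [Real.mul_rpow hC.le (Real.rpow_nonneg hr.le _), ← Real.rpow_mul hr.le, mul_comm]
      congr 2
      linarith
    have e3 : convexityTerm lam n p (fun r => C * r ^ (-k)) (fun r => -(k * C * r ^ (-k - 1))) r =
        r ^ (-k - 1 - 1) * (lam * n * k * C - C ^ p) := by
      simp only [convexityTerm]
      rw [e2, e1]
      field_simp
    rw [e3, pucciInv_mul (Real.rpow_nonneg hr.le _), hA]
    ring

/-- If the velocity and its derivative both vanished at r, f would match a singular solution C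
r^(-k) there, hence on (0, r]; but r^k f tends to 0 at the origin. -/
theorem fowler_ne_equilibrium (hlam : 0 < lam) (hLam : lam ≤ Lam) (hn : 0 ≤ n) (hp : 1 ≤ p)
    (hk0 : 0 < k) (hk : k + 2 = k * p) (h : ProfileODE lam Lam n p f g) {A : ℝ}
    (hf : Tendsto f (𝓝[>] 0) (𝓝 A)) {r : ℝ} (hr : 0 < r) (h0 : k * f r + r * g r = 0) :
    (k + 1) * g r + r * pucciInv lam Lam (convexityTerm lam n p f g r) ≠ 0 := by
  intro h1
  have hfr := h.pos r hr
  set C := r ^ k * f r with hCdef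
  have hC : 0 < C := mul_pos (Real.rpow_pos_of_pos hr _) hfr
  have hkr : r ^ (-k) * r ^ k = 1 := by rw [← Real.rpow_add hr]; simp
  have ef : f r = C * r ^ (-k) := by
    rw [hCdef]
    linear_combination -(f r) * hkr
  have e1 : r ^ (-k - 1) * r = r ^ (-k) := by rw [← Real.rpow_add_one hr.ne']; ring_nf
  have e2 : r ^ (-k - 2) * r = r ^ (-k - 1) := by rw [← Real.rpow_add_one hr.ne']; ring_nf
  have eg : g r = -(k * C * r ^ (-k - 1)) := by
    have : r * g r = r * -(k * C * r ^ (-k - 1)) := by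
      have : r * -(k * C * r ^ (-k - 1)) = -(k * (C * (r ^ (-k - 1) * r))) := by ring
      rw [this, e1, ← ef]
      linarith
    exact mul_left_cancel₀ hr.ne' this
  have eK : convexityTerm lam n p f g r = r ^ (-k - 2) * (lam * n * k * C - C ^ p) := by
    have e3 : (C * r ^ (-k)) ^ p = r ^ (-k - 2) * C ^ p := by
      rw [Real.mul_rpow hC.le (Real.rpow_nonneg hr.le _), ← Real.rpow_mul hr.le, mul_comm]
      congr 2
      linarith
    simp only [convexityTerm]
    rw [eg, ef, e3, ← e2]
    field_simp
  have hq : 0 < r ^ (-k - 2) := Real.rpow_pos_of_pos hr _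
  have hA : pucciInv lam Lam (lam * n * k * C - C ^ p) = k * (k + 1) * C := by
    rw [eK, pucciInv_mul hq.le, eg, ← e2] at h1
    have : r * r ^ (-k - 2) * (pucciInv lam Lam (lam * n * k * C - C ^ p) - k * (k + 1) * C) = 0 := by
      linear_combination h1
    rcases mul_eq_zero.1 this with h | h
    · exact absurd h (mul_pos hr hq).ne'
    · linarith
  have h2 := of_rpow (n := n) hk0 hk hC hA
  have key : ∀ᶠ a in 𝓝[>] 0, a ^ k * f a = C := by
    filter_upwards [Ioo_mem_nhdsGT hr] with a ha
    have := eq_of_eq_right hlam hLam hn hp h h2 ef eg ha.1 ha.2.le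
    have h3 : a ^ (-k) * a ^ k = 1 := by rw [← Real.rpow_add ha.1]; simp
    rw [this]
    linear_combination C * h3
  have := tendsto_nhds_unique ((tendsto_rpow_mul_zero hk0 hf).congr' key) tendsto_const_nhds
  linarith

theorem hasDerivAt_fowler (h : ProfileODE lam Lam n p f g) {r : ℝ} (hr : 0 < r) :
    HasDerivAt (fun r => r ^ k * f r) ((r ^ k * (k * f r + r * g r)) / r) r := by
  refine ((Real.hasDerivAt_rpow_const (p := k) (Or.inl hr.ne')).mul
    (h.hasDerivAt r hr)).congr_deriv ?_
  rw [Real.rpow_sub_one hr.ne']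
  field_simp

theorem hasDerivAt_fowler_velocity (h : ProfileODE lam Lam n p f g) {r : ℝ} (hr : 0 < r) :
    HasDerivAt (fun r => r ^ k * (k * f r + r * g r))
      (k * r ^ (k - 1) * (k * f r + r * g r) + r ^ k *
        ((k + 1) * g r + r * pucciInv lam Lam (convexityTerm lam n p f g r))) r := by
  refine ((Real.hasDerivAt_rpow_const (p := k) (Or.inl hr.ne')).mul
    (((h.hasDerivAt r hr).const_mul k).add
      ((hasDerivAt_id r).mul (h.hasDerivAt_deriv r hr)))).congr_deriv ?_
  simp only [Pi.add_apply, Pi.mul_apply, id]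
  ring

/-- Applies `pos_of_pos_right` to w = r^k f and v = r w'. Since v = k w + r^(k+1) g, injectivity of
(w, r^(k+1) g) transfers to (w, v). -/
theorem fowler_velocity_pos (hlam : 0 < lam) (hLam : lam ≤ Lam) (hn : 0 ≤ n) (hp : 1 ≤ p)
    (hk0 : 0 < k) (hk : k + 2 = k * p) (h : ProfileODE lam Lam n p f g) {A : ℝ} (hA : 0 < A)
    (hf : Tendsto f (𝓝[>] 0) (𝓝 A)) (hg : Tendsto g (𝓝[>] 0) (𝓝 0))
    (hwi : Tendsto (fun r => r ^ k * f r) atTop (𝓝 0)) {a b : ℝ} (ha : 0 < a) (hab : a ≤ b)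
    (hb : 0 < k * f b + b * g b) : 0 < k * f a + a * g a := by
  have hpos : ∀ {r : ℝ}, 0 < r → 0 < r ^ k := fun hr => Real.rpow_pos_of_pos hr k
  have hid : Tendsto (fun r : ℝ => r) (𝓝[>] 0) (𝓝 0) := tendsto_id.mono_left nhdsWithin_le_nhds
  have hv0 : ∀ᶠ r in 𝓝[>] 0, 0 < r ^ k * (k * f r + r * g r) := by
    have : Tendsto (fun r => k * f r + r * g r) (𝓝[>] 0) (𝓝 (k * A + 0 * 0)) :=
      (hf.const_mul k).add (hid.mul hg)
    filter_upwards [this.eventually_const_lt (u := 0) (by positivity), self_mem_nhdsWithin]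
      with r hr hr0
    exact mul_pos (hpos hr0) hr
  refine pos_of_mul_pos_right (pos_of_pos_right (v := fun r => r ^ k * (k * f r + r * g r))
    (fun r hr => h.hasDerivAt_fowler hr) (fun r hr => h.hasDerivAt_fowler_velocity hr) ?_ ?_
    (fun r hr => mul_pos (hpos hr) (h.pos r hr)) (tendsto_rpow_mul_zero hk0 hf) hwi hv0 ha hab
    (mul_pos (hpos (ha.trans_le hab)) hb)) (hpos ha).le
  · intro r hr hv
    have hv := (mul_eq_zero.1 hv).resolve_left (hpos hr).ne'
    rw [hv, mul_zero, zero_add]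
    exact mul_ne_zero (hpos hr).ne' (h.fowler_ne_equilibrium hlam hLam hn hp hk0 hk hf hr hv)
  · intro s t hs hst hw hv
    refine h.fowler_injective hlam hLam hn hp hk0 hk hA hf hs hst hw ?_
    rw [Real.rpow_add_one hs.ne', Real.rpow_add_one (hs.trans hst).ne']
    linear_combination hv - k * hw

/-! ### A single change of convexity -/

theorem hasDerivAt_convexityTerm (h : ProfileODE lam Lam n p f g) {r : ℝ} (hr : 0 < r) :
    HasDerivAt (convexityTerm lam n p f g)
      (-(lam * n / r * pucciInv lam Lam (convexityTerm lam n p f g r)) +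
        -g r / r ^ 2 * (p * (r ^ 2 * f r ^ (p - 1)) - lam * n)) r := by
  refine ((((h.hasDerivAt_deriv r hr).const_mul (lam * n)).div (hasDerivAt_id r) hr.ne').neg.sub
    ((h.hasDerivAt r hr).rpow_const (p := p) (Or.inl (h.pos r hr).ne'))).congr_deriv ?_
  simp only [id]
  field_simp
  ring

/-- At a zero, λn·r|g| = r² f^p, so the bound gives p·r|g| ≤ f. Since kp = k + 2, this yields p(kf +
rg) ≥ (k+1)f > 0. -/
theorem velocity_pos_of_convexityTerm_eq_zero (hlam : 0 < lam) (hn : 0 < n) (hp : 1 < p)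
    (hk : k + 2 = k * p) (h : ProfileODE lam Lam n p f g) {r : ℝ} (hr : 0 < r)
    (hK : convexityTerm lam n p f g r = 0) (hG : p * (r ^ 2 * f r ^ (p - 1)) ≤ lam * n) :
    0 < k * f r + r * g r := by
  have hf := h.pos r hr
  have e : f r ^ p = f r ^ (p - 1) * f r := by
    rw [← Real.rpow_add_one hf.ne']; ring_nf
  have h1 : lam * n * (r * -g r) = r ^ 2 * f r ^ (p - 1) * f r := by
    simp only [convexityTerm, e] at hK
    field_simp at hK
    linear_combination r * hK
  have h2 : lam * n * (p * (r * -g r)) ≤ lam * n * f r := by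
    have e2 : lam * n * (p * (r * -g r)) = p * (r ^ 2 * f r ^ (p - 1)) * f r := by
      linear_combination p * h1
    rw [e2]
    exact mul_le_mul_of_nonneg_right hG hf.le
  have h3 : p * (r * -g r) ≤ f r := le_of_mul_le_mul_left h2 (by positivity)
  have h4 : 0 < p * (k * f r + r * g r) := by
    have : p * (k * f r + r * g r) = (k + 2) * f r - p * (r * -g r) := by rw [hk]; ring
    rw [this]
    nlinarith
  exact pos_of_mul_pos_right h4 (by linarith)

/-- Otherwise f would be concave with negative slope on [a, ∞), hence below a decreasing line, and
would lose positivity. -/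
theorem exists_convexityTerm_nonneg (hlam : 0 < lam) (hLam : lam ≤ Lam)
    (h : ProfileODE lam Lam n p f g) {a : ℝ} (ha : 0 < a) :
    ∃ b, a ≤ b ∧ 0 ≤ convexityTerm lam n p f g b := by
  by_contra! hcon
  have hga := h.neg a ha
  have hanti : AntitoneOn g (Set.Ici a) := by
    refine antitoneOn_of_deriv_nonpos (convex_Ici a)
      (fun x hx => (h.continuousAt_deriv (ha.trans_le hx)).continuousWithinAt) ?_ ?_ <;>
      rw [interior_Ici] <;> intro x hx
    · exact (h.hasDerivAt_deriv x (ha.trans hx)).differentiableAt.differentiableWithinAt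
    · rw [(h.hasDerivAt_deriv x (ha.trans hx)).deriv]
      exact ((pucciInv_neg_iff hlam hLam).2 (hcon x (le_of_lt hx))).le
  have hF : ∀ x, 0 < x → HasDerivAt (fun r => f r - g a * r) (g x - g a * 1) x := fun x hx =>
    (h.hasDerivAt x hx).sub ((hasDerivAt_id x).const_mul (g a))
  have hanti2 : AntitoneOn (fun r => f r - g a * r) (Set.Ici a) := by
    refine antitoneOn_of_deriv_nonpos (convex_Ici a)
      (fun x hx => (hF x (ha.trans_le hx)).continuousAt.continuousWithinAt) ?_ ?_ <;>
      rw [interior_Ici] <;> intro x hx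
    · exact (hF x (ha.trans hx)).differentiableAt.differentiableWithinAt
    · rw [(hF x (ha.trans hx)).deriv]
      linarith [hanti (Set.self_mem_Ici) (le_of_lt hx : a ≤ x) (le_of_lt hx)]
  have hfa := h.pos a ha
  have hb : a ≤ a + f a / -g a := by
    have : 0 < f a / -g a := div_pos hfa (by linarith)
    linarith
  have := hanti2 Set.self_mem_Ici hb hb
  have e : g a * (a + f a / -g a) = g a * a - f a := by
    have := hga.ne
    field_simp
    ring
  simp only [e] at this
  linarith [h.pos _ (ha.trans_le hb)]

/-- The convexity of the profile changes exactly once. -/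
theorem exists_unique_inflection (hlam : 0 < lam) (hLam : lam ≤ Lam) (hn : 0 < n) (hp : 1 < p)
    (hk : k + 2 = k * p) (h : ProfileODE lam Lam n p f g)
    (hv : ∀ a b, 0 < a → a ≤ b → 0 < k * f b + b * g b → 0 < k * f a + a * g a)
    (hK0 : ∀ᶠ r in 𝓝[>] 0, convexityTerm lam n p f g r < 0) :
    ∃ r₀, 0 < r₀ ∧ convexityTerm lam n p f g r₀ = 0 ∧
      (∀ r, 0 < r → r < r₀ → convexityTerm lam n p f g r < 0) ∧
      ∀ r, r₀ < r → 0 < convexityTerm lam n p f g r := by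
  set K := convexityTerm lam n p f g with hKdef
  set G : ℝ → ℝ := fun r => p * (r ^ 2 * f r ^ (p - 1)) with hGdef
  have cK : ∀ {s : Set ℝ}, s ⊆ Set.Ioi 0 → ContinuousOn K s :=
    fun hs x hx => (h.hasDerivAt_convexityTerm (hs hx)).continuousAt.continuousWithinAt
  have sub : ∀ {x y : ℝ}, 0 < x → Set.Icc x y ⊆ Set.Ioi 0 := fun hx z hz => hx.trans_le hz.1
  -- Since k(p-1) = 2, G is p (r^k f)^(p-1), so it increases together with r^k f.
  have Gmono : ∀ {a b : ℝ}, 0 < a → a < b → 0 < k * f b + b * g b → G a < G b := by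
    intro a b ha hab hb
    have hw : StrictMonoOn (fun r => r ^ k * f r) (Set.Icc a b) := by
      refine strictMonoOn_of_hasDerivAt_pos (convex_Icc _ _)
        (F' := fun r => (r ^ k * (k * f r + r * g r)) / r)
        (fun x hx => (h.hasDerivAt_fowler (sub ha hx)).continuousAt.continuousWithinAt)
        fun x hx => ?_
      rw [interior_Icc] at hx
      have hx0 := ha.trans hx.1
      exact ⟨h.hasDerivAt_fowler hx0, div_pos (mul_pos (Real.rpow_pos_of_pos hx0 _)
        (hv x b hx0 hx.2.le hb)) hx0⟩
    have h1 := hw ⟨le_rfl, hab.le⟩ ⟨hab.le, le_rfl⟩ hab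
    have e : ∀ r, 0 < r → (r ^ k * f r) ^ (p - 1) = r ^ 2 * f r ^ (p - 1) := fun r hr => by
      rw [Real.mul_rpow (Real.rpow_nonneg hr.le _) (h.pos r hr).le, ← Real.rpow_mul hr.le,
        show k * (p - 1) = (2 : ℕ) by push_cast; linarith, Real.rpow_natCast]
    have h2 := Real.rpow_lt_rpow (mul_nonneg (Real.rpow_nonneg ha.le _) (h.pos a ha).le) h1
      (sub_pos.2 hp)
    rw [e a ha, e b (ha.trans hab)] at h2
    exact mul_lt_mul_of_pos_left h2 (by linarith)
  obtain ⟨a, ha, -, hKa⟩ := exists_right_of_eventually hK0 one_pos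
  obtain ⟨b, hab, hKb⟩ := h.exists_convexityTerm_nonneg hlam hLam ha
  obtain ⟨r₀, har₀, -, hK₀, hneg⟩ := exists_first_zero (F := fun r => -K r) hab (cK (sub ha)).neg
    (by linarith [hKa a ha le_rfl]) (by linarith)
  have hK₀ : K r₀ = 0 := neg_eq_zero.1 hK₀
  have hr₀ := ha.trans har₀
  have before : ∀ r, 0 < r → r < r₀ → K r < 0 := fun r h0 h1 => by
    rcases le_total r a with h | h
    · exact hKa r h0 h
    · linarith [hneg r h h1]
  have hG₀ : lam * n < G r₀ := by
    by_contra! hle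
    have hv₀ := h.velocity_pos_of_convexityTerm_eq_zero hlam hn hp hk hr₀ hK₀ hle
    -- Where K < 0, `pucciInv` divides by λ, so the factor r^n cancels the linear term exactly and
    -- the sign of (r^n K)' is that of G - λn. Then r^n K would decrease to 0 at `r₀`, contradicting
    -- K < 0 before.
    have hF : ∀ x, 0 < x → HasDerivAt (fun r => r ^ n * K r) (n * x ^ (n - 1) * K x + x ^ n *
        (-(lam * n / x * pucciInv lam Lam (K x)) + -g x / x ^ 2 * (G x - lam * n))) x :=
      fun x hx => (Real.hasDerivAt_rpow_const (Or.inl hx.ne')).mul (h.hasDerivAt_convexityTerm hx)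
    have hanti : StrictAntiOn (fun r => r ^ n * K r) (Set.Icc (r₀ / 2) r₀) := by
      refine strictAntiOn_of_deriv_neg (convex_Icc _ _)
        (fun x hx => (hF x (sub (half_pos hr₀) hx)).continuousAt.continuousWithinAt) fun x hx => ?_
      rw [interior_Icc] at hx
      have hx0 : 0 < x := (half_pos hr₀).trans hx.1
      rw [(hF x hx0).deriv, pucciInv_of_nonpos hlam hLam (before x hx0 hx.2).le,
        Real.rpow_sub_one hx0.ne']
      have e : n * (x ^ n / x) * K x + x ^ n *
          (-(lam * n / x * (K x / lam)) + -g x / x ^ 2 * (G x - lam * n)) =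
          x ^ n * (-g x / x ^ 2 * (G x - lam * n)) := by
        field_simp
        ring
      rw [e]
      refine mul_neg_of_pos_of_neg (Real.rpow_pos_of_pos hx0 _) (mul_neg_of_pos_of_neg
        (div_pos (neg_pos.2 (h.neg x hx0)) (by positivity)) ?_)
      linarith [Gmono hx0 hx.2 hv₀]
    have h1 := hanti ⟨le_rfl, by linarith⟩ ⟨by linarith, le_rfl⟩ (half_lt_self hr₀)
    simp only [hK₀, mul_zero] at h1
    exact absurd (mul_neg_of_pos_of_neg (Real.rpow_pos_of_pos (half_pos hr₀) n)
      (before _ (half_pos hr₀) (half_lt_self hr₀))) (not_lt.2 h1.le)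
  refine ⟨r₀, hr₀, hK₀, before, fun r hr => ?_⟩
  by_contra! hKr
  have hd := h.hasDerivAt_convexityTerm hr₀
  rw [← hKdef, hK₀, pucciInv_of_nonneg hlam hLam le_rfl, zero_div, mul_zero, neg_zero,
    zero_add] at hd
  obtain ⟨c, hc, hcr, hKc⟩ := exists_right_of_eventually (eventually_pos_right hd hK₀
    (mul_pos (div_pos (neg_pos.2 (h.neg r₀ hr₀)) (by positivity)) (by linarith))) hr
  obtain ⟨t, hct, -, hKt, hpos⟩ := exists_first_zero hcr.le (cK (sub (hr₀.trans hc)))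
    (hKc c hc le_rfl) hKr
  have ht0 := (hr₀.trans hc).trans hct
  have hd' := deriv_nonpos_of_pos_left (h.hasDerivAt_convexityTerm ht0) hKt hct
    fun y h1 h2 => hpos y h1.le h2
  rw [← hKdef, hKt, pucciInv_of_nonneg hlam hLam le_rfl, zero_div, mul_zero, neg_zero,
    zero_add] at hd'
  -- A second zero is reached from K > 0, so K' ≤ 0 there. The velocity is then positive at t, and
  -- monotonicity of G gives G r₀ < G t ≤ λn, against `hG₀`.
  have hGt : G t ≤ lam * n := by
    by_contra! hlt
    exact absurd (mul_pos (div_pos (neg_pos.2 (h.neg t ht0)) (by positivity)) (sub_pos.2 hlt))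
      (not_lt.2 hd')
  have := Gmono hr₀ (hc.trans hct)
    (h.velocity_pos_of_convexityTerm_eq_zero hlam hn hp hk ht0 hKt hGt)
  linarith

/-! ### Consequences of fast decay for the exponent -/

/-- A fast decaying solution exists only for supercritical exponents in the sense of Serrin. -/
theorem add_one_lt_of_fastDecay (hlam : 0 < lam) (hLam : lam ≤ Lam) (hp : 1 < p)
    (h : ProfileODE lam Lam n p f g) {a c l : ℝ} (ha : a = lam / Lam * n) (hc : 0 < c)
    (hf : Tendsto (fun r => r ^ (a - 1) * f r) atTop (𝓝 c))
    (hg : Tendsto (fun r => r ^ a * g r) atTop (𝓝 l)) : a + 1 < p * (a - 1) := by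
  by_contra! hle
  have hL := hlam.trans_le hLam
  obtain ⟨R, hR⟩ := eventually_atTop.1
    ((hf.eventually_const_lt (half_lt_self hc)).and (eventually_ge_atTop 1))
  have hR1 : 1 ≤ R := (hR R le_rfl).2
  -- If p(a-1) ≤ a+1, then r^a f^p ≥ (c/2)^p / r for large r. With this κ the function r^a g + κ log
  -- r is nonincreasing, so r^a g cannot converge.
  set κ := (c / 2) ^ p / Lam
  have hκ : 0 < κ := div_pos (Real.rpow_pos_of_pos (half_pos hc) _) hL
  have hF : ∀ x, 0 < x → HasDerivAt (fun r => r ^ a * g r + κ * Real.log r)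
      (a * x ^ (a - 1) * g x + x ^ a * pucciInv lam Lam (convexityTerm lam n p f g x) +
        κ * x⁻¹) x := fun x hx =>
    ((Real.hasDerivAt_rpow_const (Or.inl hx.ne')).mul (h.hasDerivAt_deriv x hx)).add
      ((Real.hasDerivAt_log hx.ne').const_mul κ)
  have hanti : AntitoneOn (fun r => r ^ a * g r + κ * Real.log r) (Set.Ici R) := by
    refine antitoneOn_of_deriv_nonpos (convex_Ici R)
      (fun x hx => (hF x (by have := Set.mem_Ici.1 hx; linarith)).continuousAt.continuousWithinAt)
      ?_ ?_ <;> rw [interior_Ici] <;> intro x hx <;>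
      have hx0 : 0 < x := by { have := Set.mem_Ioi.1 hx; linarith }
    · exact (hF x hx0).differentiableAt.differentiableWithinAt
    rw [(hF x hx0).deriv]
    obtain ⟨h1, h2⟩ := hR x (le_of_lt hx)
    have hfx := h.pos x hx0
    have h3 : pucciInv lam Lam (convexityTerm lam n p f g x) ≤ convexityTerm lam n p f g x / Lam :=
      min_le_right _ _
    have h4 : x ^ a * pucciInv lam Lam (convexityTerm lam n p f g x) ≤
        x ^ a * (convexityTerm lam n p f g x / Lam) :=
      mul_le_mul_of_nonneg_left h3 (Real.rpow_nonneg hx0.le _)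
    have h5 : a * x ^ (a - 1) * g x + x ^ a * (convexityTerm lam n p f g x / Lam) =
        -(x ^ a * f x ^ p / Lam) := by
      rw [Real.rpow_sub_one hx0.ne', ha, convexityTerm]
      field_simp
      ring
    have h6 : (c / 2) ^ p * x⁻¹ ≤ x ^ a * f x ^ p := by
      have e : x ^ a * f x ^ p = (x ^ (a - 1) * f x) ^ p * x ^ (a - p * (a - 1)) := by
        rw [Real.mul_rpow (Real.rpow_nonneg hx0.le _) hfx.le, ← Real.rpow_mul hx0.le,
          Real.rpow_sub hx0, mul_comm p]
        field_simp
      rw [e, ← Real.rpow_neg_one]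
      refine mul_le_mul (Real.rpow_le_rpow (by positivity) h1.le (by linarith))
        (Real.rpow_le_rpow_of_exponent_le h2 (by linarith)) (by positivity) (by positivity)
    have h7 : κ * x⁻¹ ≤ x ^ a * f x ^ p / Lam := by
      have := div_le_div_of_nonneg_right h6 hL.le
      calc κ * x⁻¹ = (c / 2) ^ p * x⁻¹ / Lam := by simp only [κ]; ring
        _ ≤ _ := this
    linarith
  have hbot : Tendsto (fun r => R ^ a * g R + κ * Real.log R - κ * Real.log r) atTop atBot :=
    tendsto_atBot_add_const_left _ _
      (tendsto_neg_atTop_atBot.comp (Real.tendsto_log_atTop.const_mul_atTop hκ))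
  refine not_tendsto_nhds_of_tendsto_atBot (tendsto_atBot_mono' atTop ?_ hbot) _ hg
  filter_upwards [eventually_ge_atTop R] with r hr
  have := hanti Set.self_mem_Ici hr hr
  simp only at this
  linarith

theorem tendsto_fowler_atTop {a c : ℝ} (ha : k < a - 1)
    (hf : Tendsto (fun r => r ^ (a - 1) * f r) atTop (𝓝 c)) :
    Tendsto (fun r => r ^ k * f r) atTop (𝓝 0) := by
  have h1 : Tendsto (fun r : ℝ => r ^ (-(a - 1 - k))) atTop (𝓝 0) :=
    tendsto_rpow_neg_atTop (by linarith)
  have h2 := h1.mul hf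
  rw [zero_mul] at h2
  refine h2.congr' ?_
  filter_upwards [eventually_gt_atTop 0] with r hr
  rw [← mul_assoc, ← Real.rpow_add hr]
  congr 2
  ring

end ProfileODE

/-! ### The Pucci operator on matrices -/

section pucciMax

open Polynomial

variable {N : ℕ} {lam Lam : ℝ}

/-- The contribution `Λ μ⁺ - λ μ⁻` of an eigenvalue to the maximal Pucci operator. -/
def pucciTerm (lam Lam μ : ℝ) : ℝ := Lam * max μ 0 + lam * min μ 0

theorem pucciTerm_of_nonneg {μ : ℝ} (h : 0 ≤ μ) : pucciTerm lam Lam μ = Lam * μ := by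
  simp [pucciTerm, h]

theorem pucciTerm_of_nonpos {μ : ℝ} (h : μ ≤ 0) : pucciTerm lam Lam μ = lam * μ := by
  simp [pucciTerm, h]

theorem pucciTerm_mul {c : ℝ} (hc : 0 ≤ c) (μ : ℝ) :
    pucciTerm lam Lam (c * μ) = c * pucciTerm lam Lam μ := by
  have h1 : max (c * μ) 0 = c * max μ 0 := by rw [mul_max_of_nonneg _ _ hc, mul_zero]
  have h2 : min (c * μ) 0 = c * min μ 0 := by rw [mul_min_of_nonneg _ _ hc, mul_zero]
  rw [pucciTerm, pucciTerm, h1, h2]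
  ring

theorem eq_pucciInv_of_pucciTerm_eq (hlam : 0 < lam) (hLam : lam ≤ Lam) {m K : ℝ}
    (h : pucciTerm lam Lam m = K) : m = pucciInv lam Lam K := by
  have hL := hlam.trans_le hLam
  rcases le_total 0 m with hm | hm
  · rw [pucciTerm_of_nonneg hm] at h
    rw [pucciInv_of_nonneg hlam hLam (h ▸ mul_nonneg hL.le hm), ← h]
    field_simp
  · rw [pucciTerm_of_nonpos hm] at h
    rw [pucciInv_of_nonpos hlam hLam (h ▸ mul_nonpos_of_nonneg_of_nonpos hlam.le hm), ← h]
    field_simp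

theorem pucciMax_eq_sum (A : Matrix (Fin N) (Fin N) ℝ) :
    pucciMax lam Lam A = (A.charpoly.roots.map (pucciTerm lam Lam)).sum := by
  rw [pucciMax]
  induction A.charpoly.roots using Multiset.induction_on with
  | empty => simp
  | cons a s ih =>
    rw [Multiset.map_cons, Multiset.sum_cons, ← ih]
    rcases lt_trichotomy a 0 with h | h | h
    · rw [Multiset.filter_cons_of_neg (p := fun μ => 0 < μ) _ h.not_gt,
        Multiset.filter_cons_of_pos (p := fun μ => μ < 0) _ h,
        Multiset.sum_cons, pucciTerm_of_nonpos h.le]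
      ring
    · subst h
      simp [pucciTerm]
    · rw [Multiset.filter_cons_of_pos (p := fun μ => 0 < μ) _ h,
        Multiset.filter_cons_of_neg (p := fun μ => μ < 0) _ h.not_gt,
        Multiset.sum_cons, pucciTerm_of_nonneg h.le]
      ring

theorem pucciMax_diagonal (d : Fin N → ℝ) :
    pucciMax lam Lam (Matrix.diagonal d) = ∑ i, pucciTerm lam Lam (d i) := by
  have : (Matrix.diagonal d).charpoly.roots = Finset.univ.val.map d := by
    rw [Matrix.charpoly_diagonal, Finset.prod_eq_multiset_prod,
      ← roots_multiset_prod_X_sub_C (Finset.univ.val.map d), Multiset.map_map]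
    rfl
  rw [pucciMax_eq_sum, this, Multiset.map_map]
  rfl

/-- Transfers the scaling to the real roots with multiplicity for an arbitrary matrix, without
diagonalising it. -/
theorem charpoly_smul_comp (c : ℝ) (A : Matrix (Fin N) (Fin N) ℝ) :
    (c • A).charpoly.comp (C c * Polynomial.X + C 0) = C (c ^ N) * A.charpoly := by
  have h := (compRingHom (C c * Polynomial.X + C 0 : ℝ[X])).map_det (c • A).charmatrix
  rw [Matrix.charpoly, ← coe_compRingHom_apply, h, Matrix.charpoly, C_pow]
  have : (compRingHom (C c * Polynomial.X + C 0 : ℝ[X])).mapMatrix (c • A).charmatrix =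
      (C c : ℝ[X]) • A.charmatrix := by
    ext1 i j
    by_cases hij : i = j
    · subst hij
      simp [mul_sub]
    · simp [hij]
  rw [this, Matrix.det_smul, Fintype.card_fin]

theorem pucciMax_smul {c : ℝ} (hc : 0 < c) (A : Matrix (Fin N) (Fin N) ℝ) :
    pucciMax lam Lam (c • A) = c * pucciMax lam Lam A := by
  have h1 := map_roots_comp_C_mul_X_add_C (c • A).charpoly c 0 hc.ne'.isUnit
  rw [charpoly_smul_comp, roots_C_mul _ (pow_ne_zero _ hc.ne')] at h1
  rw [pucciMax_eq_sum, pucciMax_eq_sum, ← h1, Multiset.map_map, ← Multiset.sum_map_mul_left]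
  congr 1
  refine Multiset.map_congr rfl fun x _ => ?_
  simp [pucciTerm_mul hc.le]

end pucciMax

/-! ### Derivatives of radial functions -/

section radial

variable {N : ℕ} [NeZero N] {lam Lam p : ℝ} {u : EuclideanSpace ℝ (Fin N) → ℝ}

theorem hasFDerivAt_norm_of_ne_zero {E : Type*} [NormedAddCommGroup E] [InnerProductSpace ℝ E]
    {x : E} (hx : x ≠ 0) : HasFDerivAt (fun y : E => ‖y‖) (‖x‖⁻¹ • innerSL ℝ x) x := by
  have h := (hasStrictFDerivAt_norm_sq x).hasFDerivAt.sqrt (by simpa using hx)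
  simp only [Real.sqrt_sq (norm_nonneg _)] at h
  refine h.congr_fderiv ?_
  ext y
  simp
  field_simp

theorem IsRadial.eq_profile (hu : IsRadial u) (x : EuclideanSpace ℝ (Fin N)) :
    u x = profile u ‖x‖ :=
  hu _ _ (by simp)

theorem profile_eq_comp (u : EuclideanSpace ℝ (Fin N) → ℝ) :
    profile u = u ∘ fun r : ℝ => r • EuclideanSpace.single (0 : Fin N) (1 : ℝ) := by
  ext r
  simp only [profile, Function.comp]
  congr 1
  ext i
  by_cases h : i = 0 <;> simp [h]

theorem contDiff_profile (hu : ContDiff ℝ 2 u) : ContDiff ℝ 2 (profile u) := by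
  rw [profile_eq_comp]
  exact hu.comp (contDiff_id.smul contDiff_const)

theorem hasDerivAt_profile (hu : ContDiff ℝ 2 u) (r : ℝ) :
    HasDerivAt (profile u) (deriv (profile u) r) r :=
  ((contDiff_profile hu).differentiable (by norm_num) r).hasDerivAt

theorem contDiff_deriv_profile (hu : ContDiff ℝ 2 u) : ContDiff ℝ 1 (deriv (profile u)) :=
  (contDiff_succ_iff_deriv.1 ((contDiff_profile hu : ContDiff ℝ (1 + 1) _))).2.2

theorem hasDerivAt_deriv_profile (hu : ContDiff ℝ 2 u) (r : ℝ) :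
    HasDerivAt (deriv (profile u)) (deriv (deriv (profile u)) r) r :=
  ((contDiff_deriv_profile hu).differentiable (by norm_num) r).hasDerivAt

theorem continuous_deriv_deriv_profile (hu : ContDiff ℝ 2 u) :
    Continuous (deriv (deriv (profile u))) :=
  (contDiff_deriv_profile hu).continuous_deriv le_rfl

theorem IsRadial.deriv_profile_zero (hr : IsRadial u) (hu : ContDiff ℝ 2 u) :
    deriv (profile u) 0 = 0 := by
  have heven : (fun r => profile u (-r)) = profile u := by
    ext r
    exact hr _ _ (by simp)
  have h := (hasDerivAt_profile hu 0)
  have h1 : HasDerivAt (fun r => profile u (-r)) (deriv (profile u) 0 * -1) 0 :=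
    by
    have h2 := hasDerivAt_profile hu (-0)
    have := h2.comp 0 (hasDerivAt_neg 0)
    rwa [neg_zero] at this
  rw [heven] at h1
  have := h.unique h1
  linarith

theorem IsRadial.hasFDerivAt (hr : IsRadial u) (hu : ContDiff ℝ 2 u)
    {x : EuclideanSpace ℝ (Fin N)} (hx : x ≠ 0) :
    HasFDerivAt u ((deriv (profile u) ‖x‖ / ‖x‖) • innerSL ℝ x) x := by
  have h : u = profile u ∘ fun y => ‖y‖ := funext hr.eq_profile
  have h1 := (hasDerivAt_profile hu ‖x‖).comp_hasFDerivAt x (hasFDerivAt_norm_of_ne_zero hx)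
  rw [← h] at h1
  refine h1.congr_fderiv ?_
  rw [smul_smul, div_eq_mul_inv]

/-- On the first axis the Hessian is already diagonal, so its eigenvalues are read off without a
rotation; this is enough to obtain the ODE for the profile. -/
theorem IsRadial.hessian_single (hr : IsRadial u) (hu : ContDiff ℝ 2 u) {r : ℝ} (h0 : 0 < r) :
    hessian u (EuclideanSpace.single (0 : Fin N) r) =
      Matrix.diagonal fun i => if i = 0 then deriv (deriv (profile u)) r
        else deriv (profile u) r / r := by
  set x := EuclideanSpace.single (0 : Fin N) r with hxdef
  have hxn : ‖x‖ = r := by simp [hxdef, abs_of_pos h0]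
  have hx : x ≠ 0 := norm_ne_zero_iff.1 (by rw [hxn]; exact h0.ne')
  have hψ : HasDerivAt (fun s => deriv (profile u) s / s)
      ((deriv (deriv (profile u)) ‖x‖ * ‖x‖ - deriv (profile u) ‖x‖ * 1) / ‖x‖ ^ 2) ‖x‖ :=
    (hasDerivAt_deriv_profile hu _).div (hasDerivAt_id _) (by rw [hxn]; exact h0.ne')
  have h1 := (hψ.comp_hasFDerivAt x (hasFDerivAt_norm_of_ne_zero hx)).smul
    (innerSL ℝ (E := EuclideanSpace ℝ (Fin N))).hasFDerivAt
  have h2 : (fun y => fderiv ℝ u y) =ᶠ[𝓝 x]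
      fun y => (deriv (profile u) ‖y‖ / ‖y‖) • innerSL ℝ y := by
    filter_upwards [isOpen_ne.mem_nhds hx] with y hy
    exact (hr.hasFDerivAt hu hy).fderiv
  have h3 := (h1.congr_of_eventuallyEq h2).fderiv
  ext i j
  have hx0 : ∀ i : Fin N, inner ℝ x (EuclideanSpace.single i (1 : ℝ)) = if i = 0 then r else 0 := by
    intro i
    by_cases hi : i = 0 <;> simp [hxdef, hi, EuclideanSpace.inner_single_right]
  have hij : inner ℝ (EuclideanSpace.single i (1 : ℝ)) (EuclideanSpace.single j (1 : ℝ)) =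
      if i = j then (1 : ℝ) else 0 := by
    by_cases h : i = j <;> simp [EuclideanSpace.inner_single_right, h, eq_comm]
  have h4 : ∀ a b : EuclideanSpace ℝ (Fin N), fderiv ℝ (fderiv ℝ u) x a b =
      deriv (profile u) r / r * inner ℝ a b +
        ((deriv (deriv (profile u)) r * r - deriv (profile u) r * 1) / r ^ 2) *
          (r⁻¹ * inner ℝ x a) * inner ℝ x b := fun a b => by
    rw [← hxn]
    exact congrArg (fun L => L a b) h3
  rw [hessian, Matrix.of_apply, h4, hij, hx0, hx0, Matrix.diagonal_apply]
  have := h0.ne'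
  by_cases h : i = j
  · subst h
    by_cases hi : i = 0
    · simp only [hi, if_true]
      field_simp
      ring
    · simp [hi]
  · by_cases hi : i = 0
    · have hj : j ≠ 0 := fun hj => h (hi.trans hj.symm)
      simp [h, hj]
    · simp [h, hi]

theorem IsRadialSolution.profile_equation (hu : IsRadialSolution lam Lam p u) {r : ℝ}
    (hr : 0 < r) :
    pucciTerm lam Lam (deriv (deriv (profile u)) r) +
      ((N : ℝ) - 1) * pucciTerm lam Lam (deriv (profile u) r / r) = -profile u r ^ p := by
  have h := hu.equation (EuclideanSpace.single 0 r)
  rw [hu.radial.hessian_single hu.contDiff hr, pucciMax_diagonal,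
    ← Finset.add_sum_erase _ _ (Finset.mem_univ (0 : Fin N)),
    Finset.sum_congr rfl (g := fun _ => pucciTerm lam Lam (deriv (profile u) r / r))
      (fun i hi => by rw [if_neg (Finset.ne_of_mem_erase hi)]),
    Finset.sum_const, Finset.card_erase_of_mem (Finset.mem_univ _), Finset.card_univ,
    Fintype.card_fin, if_pos rfl, nsmul_eq_mul,
    Nat.cast_sub (Nat.one_le_iff_ne_zero.2 (NeZero.ne N)), Nat.cast_one] at h
  change _ = profile u r ^ p at h
  linarith

end radial

/-! ### Qualitative properties of radial solutions -/

section solutions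

variable {N : ℕ} [NeZero N] {lam Lam p : ℝ} {u : EuclideanSpace ℝ (Fin N) → ℝ}

theorem profile_zero (u : EuclideanSpace ℝ (Fin N) → ℝ) : profile u 0 = u 0 :=
  congrArg u (by ext i; by_cases h : i = 0 <;> simp [h])

theorem continuous_profile (hu : ContDiff ℝ 2 u) : Continuous (profile u) :=
  (contDiff_profile hu).continuous

theorem continuous_deriv_profile (hu : ContDiff ℝ 2 u) : Continuous (deriv (profile u)) :=
  (contDiff_deriv_profile hu).continuous

theorem hasDerivAt_rpow_mul_deriv_profile (hu : ContDiff ℝ 2 u) (a : ℝ) {x : ℝ} (hx : 0 < x) :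
    HasDerivAt (fun r => r ^ a * deriv (profile u) r)
      (x ^ a * (deriv (deriv (profile u)) x + a * (deriv (profile u) x / x))) x := by
  refine ((Real.hasDerivAt_rpow_const (Or.inl hx.ne')).mul
    (hasDerivAt_deriv_profile hu x)).congr_deriv ?_
  rw [Real.rpow_sub_one hx.ne']
  ring

theorem continuous_rpow_mul_deriv_profile (hu : ContDiff ℝ 2 u) {a : ℝ} (ha : 0 < a) :
    Continuous (fun r => r ^ a * deriv (profile u) r) :=
  (Real.continuous_rpow_const ha.le).mul (continuous_deriv_profile hu)

namespace IsRadialSolution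

/-- Where u' > 0 the equation gives u'' ≤ 0 and λu'' + Λ(N-1)u'/r ≤ 0, so r^k u' with k = Λ(N-1)/λ
is nonincreasing. Starting from a zero of u', it cannot become positive. -/
theorem deriv_profile_nonpos (hlam : 0 < lam) (hLam : lam ≤ Lam) (hN : 1 < N)
    (hu : IsRadialSolution lam Lam p u) {r : ℝ} (hr : 0 < r) : deriv (profile u) r ≤ 0 := by
  by_contra! hpos
  have hL := hlam.trans_le hLam
  have hN' : (0 : ℝ) < (N : ℝ) - 1 := sub_pos.2 (by exact_mod_cast hN)
  -- The reflection x ↦ -x turns a first zero into the last zero of u' before r, located at -c ∈ [0,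
  -- r).
  obtain ⟨c, hc, hc0, hcz, hcpos⟩ := exists_first_zero
    (F := fun x => deriv (profile u) (-x)) (a := -r) (b := 0) (by linarith)
    ((continuous_deriv_profile hu.contDiff).comp continuous_neg).continuousOn (by simpa using hpos)
    (by simp [hu.radial.deriv_profile_zero hu.contDiff])
  set k := Lam * ((N : ℝ) - 1) / lam with hk
  have hk0 : 0 < k := by positivity
  have hanti : AntitoneOn (fun x => x ^ k * deriv (profile u) x) (Set.Icc (-c) r) := by
    refine antitoneOn_of_deriv_nonpos (convex_Icc _ _)
      (continuous_rpow_mul_deriv_profile hu.contDiff hk0).continuousOn ?_ ?_ <;>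
      rw [interior_Icc] <;> intro x hx <;> have hx0 : 0 < x := by linarith [hx.1]
    · exact (hasDerivAt_rpow_mul_deriv_profile hu.contDiff k
        hx0).differentiableAt.differentiableWithinAt
    rw [(hasDerivAt_rpow_mul_deriv_profile hu.contDiff k hx0).deriv]
    refine mul_nonpos_of_nonneg_of_nonpos (Real.rpow_nonneg hx0.le _) ?_
    have hq : 0 < deriv (profile u) x := by
      simpa using hcpos (-x) (by linarith [hx.2]) (by linarith [hx.1])
    have hq' : 0 < deriv (profile u) x / x := div_pos hq hx0
    have he := hu.profile_equation hx0
    rw [pucciTerm_of_nonneg hq'.le] at he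
    have hup : 0 ≤ profile u x ^ p := Real.rpow_nonneg (hu.nonneg _) _
    have hlt : pucciTerm lam Lam (deriv (deriv (profile u)) x) < 0 := by
      have : 0 < ((N : ℝ) - 1) * (Lam * (deriv (profile u) x / x)) := by positivity
      linarith
    have hm : deriv (deriv (profile u)) x ≤ 0 := by
      by_contra! hm
      rw [pucciTerm_of_nonneg hm.le] at hlt
      exact absurd (mul_pos hL hm) hlt.le.not_gt
    rw [pucciTerm_of_nonpos hm] at he
    have : lam * (deriv (deriv (profile u)) x + k * (deriv (profile u) x / x)) ≤ 0 := by
      have e : lam * (deriv (deriv (profile u)) x + k * (deriv (profile u) x / x)) =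
          lam * deriv (deriv (profile u)) x + ((N : ℝ) - 1) * (Lam * (deriv (profile u) x / x)) := by
        rw [hk]
        field_simp
      linarith
    exact nonpos_of_mul_nonpos_right this hlam
  have h1 := hanti ⟨le_rfl, by linarith⟩ ⟨by linarith, le_rfl⟩ (show -c ≤ r by linarith)
  simp only [hcz, mul_zero] at h1
  exact absurd (mul_pos (Real.rpow_pos_of_pos hr k) hpos) h1.not_gt

theorem antitoneOn_profile (hlam : 0 < lam) (hLam : lam ≤ Lam) (hN : 1 < N)
    (hu : IsRadialSolution lam Lam p u) : AntitoneOn (profile u) (Set.Ici 0) := by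
  refine antitoneOn_of_deriv_nonpos (convex_Ici 0) (continuous_profile hu.contDiff).continuousOn
    (fun x _ => (hasDerivAt_profile hu.contDiff x).differentiableAt.differentiableWithinAt) ?_
  rw [interior_Ici]
  exact fun x hx => hu.deriv_profile_nonpos hlam hLam hN hx

/-- With a = λ(N-1)/Λ, the function r^a u' is nonincreasing. A zero of u' at r forces u' = 0 on (0,
r), and the equation then gives u = 0 there, against u(0) > 0. -/
theorem deriv_profile_neg (hlam : 0 < lam) (hLam : lam ≤ Lam) (hN : 1 < N)
    (hu : IsRadialSolution lam Lam p u) (h0 : 0 < u 0) {r : ℝ} (hr : 0 < r) :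
    deriv (profile u) r < 0 := by
  have hL := hlam.trans_le hLam
  have hN' : (0 : ℝ) < (N : ℝ) - 1 := sub_pos.2 (by exact_mod_cast hN)
  set a := lam * ((N : ℝ) - 1) / Lam with ha
  have ha0 : 0 < a := by positivity
  have hanti : AntitoneOn (fun x => x ^ a * deriv (profile u) x) (Set.Ici 0) := by
    refine antitoneOn_of_deriv_nonpos (convex_Ici _)
      (continuous_rpow_mul_deriv_profile hu.contDiff ha0).continuousOn ?_ ?_ <;>
      rw [interior_Ici] <;> intro x hx <;> have hx0 : 0 < x := hx
    · exact (hasDerivAt_rpow_mul_deriv_profile hu.contDiff a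
        hx0).differentiableAt.differentiableWithinAt
    rw [(hasDerivAt_rpow_mul_deriv_profile hu.contDiff a hx0).deriv]
    refine mul_nonpos_of_nonneg_of_nonpos (Real.rpow_nonneg hx0.le _) ?_
    have hq : deriv (profile u) x / x ≤ 0 :=
      div_nonpos_of_nonpos_of_nonneg (hu.deriv_profile_nonpos hlam hLam hN hx0) hx0.le
    rcases le_total (deriv (deriv (profile u)) x) 0 with hm | hm
    · have := mul_nonpos_of_nonneg_of_nonpos ha0.le hq
      linarith
    have he := hu.profile_equation hx0
    rw [pucciTerm_of_nonpos hq, pucciTerm_of_nonneg hm] at he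
    have hup : 0 ≤ profile u x ^ p := Real.rpow_nonneg (hu.nonneg _) _
    have : Lam * (deriv (deriv (profile u)) x + a * (deriv (profile u) x / x)) ≤ 0 := by
      have e : Lam * (deriv (deriv (profile u)) x + a * (deriv (profile u) x / x)) =
          Lam * deriv (deriv (profile u)) x + ((N : ℝ) - 1) * (lam * (deriv (profile u) x / x)) := by
        rw [ha]
        field_simp
      linarith
    exact nonpos_of_mul_nonpos_right this hL
  refine lt_of_le_of_ne (hu.deriv_profile_nonpos hlam hLam hN hr) fun hz => ?_
  have hzero : ∀ x ∈ Set.Ioo 0 r, deriv (profile u) x = 0 := fun x hx => by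
    have h1 := hanti (le_of_lt hx.1) hr.le hx.2.le
    simp only [hz, mul_zero] at h1
    exact le_antisymm (hu.deriv_profile_nonpos hlam hLam hN hx.1)
      (nonneg_of_mul_nonneg_right h1 (Real.rpow_pos_of_pos hx.1 a))
  have hconst : ∀ x ∈ Set.Ioo 0 r, profile u x = 0 := fun x hx => by
    have hdd : deriv (deriv (profile u)) x = 0 := by
      have : deriv (profile u) =ᶠ[𝓝 x] fun _ => 0 := by
        filter_upwards [isOpen_Ioo.mem_nhds hx] with y hy using hzero y hy
      rw [this.deriv_eq, deriv_const]
    have he := hu.profile_equation hx.1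
    rw [hdd, hzero x hx] at he
    simp only [pucciTerm, zero_div, max_self, min_self, mul_zero, add_zero] at he
    by_contra hne
    have : 0 < profile u x ^ p :=
      Real.rpow_pos_of_pos (lt_of_le_of_ne (hu.nonneg _) (Ne.symm hne)) p
    linarith
  have hlim : Tendsto (profile u) (𝓝[>] 0) (𝓝 (profile u 0)) :=
    (continuous_profile hu.contDiff).continuousAt.mono_left nhdsWithin_le_nhds
  have hlim0 : Tendsto (profile u) (𝓝[>] 0) (𝓝 0) := by
    refine (tendsto_const_nhds (x := (0 : ℝ))).congr' ?_
    filter_upwards [Ioo_mem_nhdsGT hr] with x hx using (hconst x hx).symm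
  have := tendsto_nhds_unique hlim hlim0
  rw [profile_zero] at this
  linarith

theorem profile_pos (hlam : 0 < lam) (hLam : lam ≤ Lam) (hN : 1 < N)
    (hu : IsRadialSolution lam Lam p u) (h0 : 0 < u 0) {r : ℝ} (hr : 0 ≤ r) :
    0 < profile u r := by
  have hanti : StrictAntiOn (profile u) (Set.Ici 0) := by
    refine strictAntiOn_of_deriv_neg (convex_Ici 0)
      (continuous_profile hu.contDiff).continuousOn ?_
    rw [interior_Ici]
    exact fun x hx => hu.deriv_profile_neg hlam hLam hN h0 hx
  have h1 := hanti hr (by simp; linarith : r + 1 ∈ Set.Ici 0) (lt_add_one r)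
  exact (hu.nonneg _ : 0 ≤ profile u (r + 1)).trans_lt h1

theorem pucciTerm_deriv_deriv (hlam : 0 < lam) (hLam : lam ≤ Lam) (hN : 1 < N)
    (hu : IsRadialSolution lam Lam p u) {r : ℝ} (hr : 0 < r) :
    pucciTerm lam Lam (deriv (deriv (profile u)) r) =
      convexityTerm lam ((N : ℝ) - 1) p (profile u) (deriv (profile u)) r := by
  have he := hu.profile_equation hr
  rw [pucciTerm_of_nonpos (div_nonpos_of_nonpos_of_nonneg
    (hu.deriv_profile_nonpos hlam hLam hN hr) hr.le)] at he
  rw [convexityTerm]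
  linear_combination he

theorem deriv_deriv_profile (hlam : 0 < lam) (hLam : lam ≤ Lam) (hN : 1 < N)
    (hu : IsRadialSolution lam Lam p u) {r : ℝ} (hr : 0 < r) :
    deriv (deriv (profile u)) r = pucciInv lam Lam
      (convexityTerm lam ((N : ℝ) - 1) p (profile u) (deriv (profile u)) r) :=
  eq_pucciInv_of_pucciTerm_eq hlam hLam (hu.pucciTerm_deriv_deriv hlam hLam hN hr)

theorem profileODE (hlam : 0 < lam) (hLam : lam ≤ Lam) (hN : 1 < N)
    (hu : IsRadialSolution lam Lam p u) (h0 : 0 < u 0) :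
    ProfileODE lam Lam ((N : ℝ) - 1) p (profile u) (deriv (profile u)) where
  pos _ hr := hu.profile_pos hlam hLam hN h0 hr.le
  neg _ hr := hu.deriv_profile_neg hlam hLam hN h0 hr
  hasDerivAt r _ := hasDerivAt_profile hu.contDiff r
  hasDerivAt_deriv r hr := by
    rw [← hu.deriv_deriv_profile hlam hLam hN hr]
    exact hasDerivAt_deriv_profile hu.contDiff r

/-- Both u'' and u'/r tend to u''(0), so the limit of the equation makes N times `pucciTerm` of
u''(0) equal to -u(0)^p < 0. -/
theorem eventually_convexityTerm_neg (hlam : 0 < lam) (hLam : lam ≤ Lam) (hN : 1 < N)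
    (hu : IsRadialSolution lam Lam p u) (h0 : 0 < u 0) (hp : 0 < p) :
    ∀ᶠ r in 𝓝[>] 0,
      convexityTerm lam ((N : ℝ) - 1) p (profile u) (deriv (profile u)) r < 0 := by
  have hN' : (0 : ℝ) < (N : ℝ) - 1 := sub_pos.2 (by exact_mod_cast hN)
  have hL := hlam.trans_le hLam
  have cP : Continuous (pucciTerm lam Lam) := by unfold pucciTerm; fun_prop
  set m := deriv (deriv (profile u)) 0
  have h1 : Tendsto (deriv (deriv (profile u))) (𝓝[>] 0) (𝓝 m) :=
    (continuous_deriv_deriv_profile hu.contDiff).continuousAt.mono_left nhdsWithin_le_nhds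
  have h2 : Tendsto (fun r => deriv (profile u) r / r) (𝓝[>] 0) (𝓝 m) := by
    have := (hasDerivAt_iff_tendsto_slope.1 (hasDerivAt_deriv_profile hu.contDiff 0)).mono_left
      (nhdsWithin_mono 0 fun y (hy : 0 < y) => ne_of_gt hy)
    refine this.congr fun r => ?_
    rw [slope_def_field, hu.radial.deriv_profile_zero hu.contDiff, sub_zero, sub_zero]
  have h3 : Tendsto (fun r => -profile u r ^ p) (𝓝[>] 0) (𝓝 (-u 0 ^ p)) := by
    rw [← profile_zero u]
    exact (((continuous_profile hu.contDiff).continuousAt.mono_left nhdsWithin_le_nhds).rpow_const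
      (Or.inr hp.le)).neg
  have h4 : Tendsto (fun r => -profile u r ^ p) (𝓝[>] 0)
      (𝓝 (pucciTerm lam Lam m + ((N : ℝ) - 1) * pucciTerm lam Lam m)) := by
    refine ((((cP.tendsto m).comp h1).add
      (((cP.tendsto m).comp h2).const_mul ((N : ℝ) - 1)))).congr' ?_
    filter_upwards [self_mem_nhdsWithin] with r hr
    exact hu.profile_equation hr
  have h5 := tendsto_nhds_unique h3 h4
  have h6 : pucciTerm lam Lam m < 0 := by
    have := Real.rpow_pos_of_pos h0 p
    by_contra! hcon
    have := mul_nonneg hN'.le hcon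
    linarith
  filter_upwards [((cP.tendsto m).comp h1).eventually_lt_const h6, self_mem_nhdsWithin]
    with r hr hr0
  rwa [← hu.pucciTerm_deriv_deriv hlam hLam hN hr0]

theorem apply_zero_pos (hlam : 0 < lam) (hLam : lam ≤ Lam) (hN : 1 < N)
    (hu : IsRadialSolution lam Lam p u) (hfast : IsFastDecaying lam Lam u) : 0 < u 0 := by
  refine lt_of_le_of_ne (hu.nonneg 0) fun h0 => ?_
  obtain ⟨c, hc, hlim, -⟩ := hfast
  have hz : ∀ᶠ r in atTop, r ^ (dimPlus N lam Lam - 2) * profile u r = 0 := by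
    filter_upwards [eventually_ge_atTop 0] with r hr
    have h1 := hu.antitoneOn_profile hlam hLam hN Set.self_mem_Ici hr hr
    rw [profile_zero, ← h0] at h1
    rw [le_antisymm h1 (hu.nonneg _), mul_zero]
  have := tendsto_nhds_unique (hlim.congr' hz) tendsto_const_nhds
  linarith

/-- Solutions with the same value at the origin coincide. -/
theorem eq_of_apply_zero_eq (hlam : 0 < lam) (hLam : lam ≤ Lam) (hN : 1 < N) (hp : 1 ≤ p)
    {v : EuclideanSpace ℝ (Fin N) → ℝ} (hu : IsRadialSolution lam Lam p u)
    (hv : IsRadialSolution lam Lam p v) (h0 : 0 < u 0) (huv : u 0 = v 0) : u = v := by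
  have hN' : (0 : ℝ) ≤ (N : ℝ) - 1 := sub_nonneg.2 (by exact_mod_cast hN.le)
  ext x
  rw [hu.radial.eq_profile, hv.radial.eq_profile]
  refine (hu.profileODE hlam hLam hN h0).eq_of_eq_zero hlam hLam hN' hp
    (hv.profileODE hlam hLam hN (huv ▸ h0)) (continuous_profile hu.contDiff).continuousOn
    (continuous_deriv_profile hu.contDiff).continuousOn
    (continuous_profile hv.contDiff).continuousOn
    (continuous_deriv_profile hv.contDiff).continuousOn (by rw [profile_zero, profile_zero, huv])
    ?_ (norm_nonneg x)
  rw [hu.radial.deriv_profile_zero hu.contDiff, hv.radial.deriv_profile_zero hv.contDiff]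

/-- Fast decay forces `2 / (p - 1) < Ñ₊ - 2`. -/
theorem decay_exponent_lt (hlam : 0 < lam) (hLam : lam ≤ Lam) (hN : 1 < N) (hp : 1 < p)
    (hu : IsRadialSolution lam Lam p u) (hfast : IsFastDecaying lam Lam u) :
    2 / (p - 1) < dimPlus N lam Lam - 2 := by
  have h0 := hu.apply_zero_pos hlam hLam hN hfast
  obtain ⟨c, hc, h1, h2⟩ := hfast
  have h3 := (hu.profileODE hlam hLam hN h0).add_one_lt_of_fastDecay hlam hLam hp
    (a := dimPlus N lam Lam - 1) (by simp [dimPlus]) hc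
    (by rwa [show dimPlus N lam Lam - 1 - 1 = dimPlus N lam Lam - 2 by ring]) h2
  rw [div_lt_iff₀ (sub_pos.2 hp)]
  linarith

theorem mem_X (hlam : 0 < lam) (hLam : lam ≤ Lam) (hN : 1 < N) (hp : 1 < p)
    (hu : IsRadialSolution lam Lam p u) (hfast : IsFastDecaying lam Lam u) : u ∈ X N := by
  have hN' : (0 : ℝ) < (N : ℝ) - 1 := sub_pos.2 (by exact_mod_cast hN)
  have h0 := hu.apply_zero_pos hlam hLam hN hfast
  have hode := hu.profileODE hlam hLam hN h0
  have hk0 : 0 < 2 / (p - 1) := div_pos two_pos (sub_pos.2 hp)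
  have hk : 2 / (p - 1) + 2 = 2 / (p - 1) * p := by
    have := (sub_pos.2 hp).ne'
    field_simp
    ring
  have hkd := hu.decay_exponent_lt hlam hLam hN hp hfast
  obtain ⟨c, -, hlim, -⟩ := hfast
  have hwi : Tendsto (fun r => r ^ (2 / (p - 1)) * profile u r) atTop (𝓝 0) :=
    ProfileODE.tendsto_fowler_atTop (a := dimPlus N lam Lam - 1) (c := c) (by linarith)
      (by rwa [show dimPlus N lam Lam - 1 - 1 = dimPlus N lam Lam - 2 by ring])
  have hA : 0 < profile u 0 := by rwa [profile_zero]
  have hg : Tendsto (deriv (profile u)) (𝓝[>] 0) (𝓝 0) := by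
    have := (continuous_deriv_profile hu.contDiff).tendsto 0
    rw [hu.radial.deriv_profile_zero hu.contDiff] at this
    exact this.mono_left nhdsWithin_le_nhds
  obtain ⟨r₀, hr₀, hz, hneg, hpos⟩ := hode.exists_unique_inflection hlam hLam hN' hp hk
    (fun a b ha hab hb => hode.fowler_velocity_pos hlam hLam hN'.le hp.le hk0 hk hA
      ((continuous_profile hu.contDiff).continuousAt.mono_left nhdsWithin_le_nhds) hg hwi
      ha hab hb)
    (hu.eventually_convexityTerm_neg hlam hLam hN h0 (one_pos.trans hp))
  refine ⟨hu.contDiff, hu.radial, fun x => ?_, r₀, hr₀, ?_, fun r h1 h2 => ?_, fun r h1 => ?_⟩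
  · rw [hu.radial.eq_profile]
    exact hu.profile_pos hlam hLam hN h0 (norm_nonneg x)
  · rw [hu.deriv_deriv_profile hlam hLam hN hr₀, hz]
    simp [pucciInv]
  · rw [hu.deriv_deriv_profile hlam hLam hN h1, pucciInv_neg_iff hlam hLam]
    exact hneg r h1 h2
  · rw [hu.deriv_deriv_profile hlam hLam hN (hr₀.trans h1), pucciInv_pos_iff hlam hLam]
    exact hpos r h1

end IsRadialSolution

/-! ### Finiteness of the energy -/

/-- The energy of a function of `X` which decays faster than `|x|^(-2/(p-1))` is finite. -/
theorem energy_lt_top (hp : 1 < p) (hu : u ∈ X N) {m c : ℝ} (hm : 2 / (p - 1) < m)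
    (hlim : Tendsto (fun r => r ^ m * profile u r) atTop (𝓝 c)) : energy p u < ⊤ := by
  obtain ⟨hcd, hrad, hpos, r₀, hr₀⟩ := hu
  set γ := gammaStar N p with hγ
  set s := m * (p + 1) - γ with hs
  -- Since γ + N = 2(p+1)/(p-1), equality m = 2/(p-1) would give s = N; the strict inequality is
  -- what makes (1+|x|)^(-s) integrable.
  have hNs : (N : ℝ) < s := by
    have : 2 / (p - 1) * (p + 1) < m * (p + 1) := mul_lt_mul_of_pos_right hm (by linarith)
    rw [hs, hγ, gammaStar]
    have e : 2 * ((p + 1) / (p - 1)) = 2 / (p - 1) * (p + 1) := by ring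
    linarith
  have hs0 : 0 < s := (Nat.cast_nonneg N).trans_lt hNs
  obtain ⟨R, hR⟩ := eventually_atTop.1 ((hlim.eventually_lt_const (lt_add_one c)).and
    ((eventually_ge_atTop 1).and (eventually_gt_atTop r₀)))
  obtain ⟨hR1, hRr⟩ := (hR R le_rfl).2
  have hR0 : 0 < R := one_pos.trans_le hR1
  have hφ : ∀ r, 0 < profile u r := fun r => hpos _
  have hc : 0 < c + 1 := (mul_pos (Real.rpow_pos_of_pos hR0 m) (hφ R)).trans (hR R le_rfl).1
  obtain ⟨B, hB⟩ := (isCompact_Icc (a := (0 : ℝ)) (b := R)).bddAbove_image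
    (continuous_profile hcd).continuousOn
  have hBφ : ∀ r, 0 ≤ r → r ≤ R → profile u r ≤ B := fun r h1 h2 => hB ⟨r, ⟨h1, h2⟩, rfl⟩
  have hB0 : 0 < B := (hφ 0).trans_le (hBφ 0 le_rfl hR0.le)
  set C := max (B ^ (p + 1) * (r₀ ^ γ + R ^ γ) * (1 + R) ^ s) ((c + 1) ^ (p + 1) * 2 ^ s)
  have hbound : ∀ x, u x ^ (p + 1) * weight p u x ≤ C * (1 + ‖x‖) ^ (-s) := by
    intro x
    have hx : 0 < 1 + ‖x‖ := by positivity
    rw [Real.rpow_neg hx.le, ← div_eq_mul_inv, le_div_iff₀ (Real.rpow_pos_of_pos hx _),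
      hrad.eq_profile x, weight, hr₀.inflectionRadius_eq, ← hγ]
    set r := ‖x‖
    have hr : 0 ≤ r := norm_nonneg x
    have h0 := hφ r
    have hr₀p := hr₀.pos
    rcases le_total r R with h | h
    · refine le_trans ?_ (le_max_left _ _)
      -- The sum of both end values bounds the weight on the ball whatever the sign of γ.
      have hw : (if r ≤ r₀ then r₀ ^ γ else r ^ γ) ≤ r₀ ^ γ + R ^ γ := by
        have h1 : 0 < r₀ ^ γ := Real.rpow_pos_of_pos hr₀.pos γ
        have h2 : 0 < R ^ γ := Real.rpow_pos_of_pos hR0 γ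
        split_ifs with hle
        · linarith
        · rcases le_total 0 γ with h3 | h3
          · linarith [Real.rpow_le_rpow hr h h3]
          · linarith [Real.rpow_le_rpow_of_nonpos hr₀.pos (not_le.1 hle).le h3]
      have hb := hBφ r hr h
      gcongr
    · refine le_trans ?_ (le_max_right _ _)
      obtain ⟨h1, h2, h3⟩ := hR r h
      have hr0 : 0 < r := hR0.trans_le h
      rw [if_neg (not_le.2 h3)]
      have e : profile u r ^ (p + 1) * r ^ γ = (r ^ m * profile u r) ^ (p + 1) * r ^ (-s) := by
        rw [Real.mul_rpow (Real.rpow_nonneg hr _) h0.le, ← Real.rpow_mul hr, mul_comm,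
          mul_right_comm, ← Real.rpow_add hr0, hs]
        congr 2
        ring
      have h4 : (1 + r) ^ s ≤ 2 ^ s * r ^ s := by
        rw [← Real.mul_rpow two_pos.le hr]
        exact Real.rpow_le_rpow hx.le (by linarith) hs0.le
      have h5 : r ^ (-s) * r ^ s = 1 := by rw [← Real.rpow_add hr0]; simp
      have h6 : (r ^ m * profile u r) ^ (p + 1) ≤ (c + 1) ^ (p + 1) :=
        Real.rpow_le_rpow (by positivity) h1.le (by linarith)
      calc _ = (r ^ m * profile u r) ^ (p + 1) * r ^ (-s) * (1 + r) ^ s := by rw [e]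
        _ ≤ (c + 1) ^ (p + 1) * r ^ (-s) * (2 ^ s * r ^ s) := by gcongr
        _ = (c + 1) ^ (p + 1) * 2 ^ s * (r ^ (-s) * r ^ s) := by ring
        _ = _ := by rw [h5, mul_one]
  have hint : Integrable (fun x : EuclideanSpace ℝ (Fin N) => C * (1 + ‖x‖) ^ (-s)) :=
    (integrable_one_add_norm (by simpa using hNs)).const_mul C
  exact (lintegral_mono fun x => ENNReal.ofReal_le_ofReal (hbound x)).trans_lt hint.lintegral_lt_top

end solutions

/-! ### Invariance under rescaling -/

section rescale

variable {N : ℕ} {lam Lam p α : ℝ} {u : EuclideanSpace ℝ (Fin N) → ℝ}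

theorem contDiff_rescale (hu : ContDiff ℝ 2 u) : ContDiff ℝ 2 (rescale p α u) :=
  contDiff_const.mul (hu.comp (contDiff_const_smul _))

theorem IsRadial.rescale (hu : IsRadial u) : IsRadial (rescale p α u) := fun x y hxy => by
  simp only [PucciEnergy.rescale]
  rw [hu _ (α ^ ((p - 1) / 2) • y) (by rw [norm_smul, norm_smul, hxy])]

theorem hessian_rescale (hα : 0 < α) (hu : ContDiff ℝ 2 u) (x : EuclideanSpace ℝ (Fin N)) :
    hessian (rescale p α u) x = α ^ p • hessian u (α ^ ((p - 1) / 2) • x) := by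
  set β := α ^ ((p - 1) / 2) with hβ
  have hd : Differentiable ℝ u := hu.differentiable (by norm_num)
  have h1 : fderiv ℝ (rescale p α u) = fun y => (α * β) • fderiv ℝ u (β • y) := by
    ext1 y
    have : rescale p α u = fun y => α • u (β • y) := rfl
    have hc : DifferentiableAt ℝ (fun y => u (β • y)) y :=
      hd.comp (differentiable_id.const_smul β) y
    rw [this, fderiv_fun_const_smul hc, fderiv_comp_smul,
      smul_smul]
  have hd2 : Differentiable ℝ (fderiv ℝ u) :=
    (hu.fderiv_right (m := 1) (by norm_num)).differentiable (by norm_num)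
  have h2 : fderiv ℝ (fderiv ℝ (rescale p α u)) x =
      (α * β * β) • fderiv ℝ (fderiv ℝ u) (β • x) := by
    have hc : DifferentiableAt ℝ (fun y => fderiv ℝ u (β • y)) x :=
      hd2.comp (differentiable_id.const_smul β) x
    rw [h1, fderiv_fun_const_smul hc, fderiv_comp_smul,
      smul_smul]
  have h3 : α * β * β = α ^ p := by
    rw [mul_assoc, hβ, ← Real.rpow_add hα, mul_comm, ← Real.rpow_add_one hα.ne']
    ring_nf
  ext i j
  simp [hessian, h2, h3]

theorem IsRadialSolution.rescale (hα : 0 < α) (hu : IsRadialSolution lam Lam p u) :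
    IsRadialSolution lam Lam p (rescale p α u) where
  contDiff := contDiff_rescale hu.contDiff
  radial := hu.radial.rescale
  nonneg x := mul_nonneg hα.le (hu.nonneg _)
  equation x := by
    rw [hessian_rescale hα hu.contDiff, pucciMax_smul (Real.rpow_pos_of_pos hα p), ← mul_neg,
      hu.equation, PucciEnergy.rescale, Real.mul_rpow hα.le (hu.nonneg _)]

theorem lintegral_comp_smul_of_pos {β : ℝ} (hβ : 0 < β) (F : EuclideanSpace ℝ (Fin N) → ℝ≥0∞) :
    ∫⁻ x, F (β • x) = ENNReal.ofReal (β ^ (-(N : ℝ))) * ∫⁻ x, F x := by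
  have h1 := lintegral_map_equiv F (Homeomorph.smulOfNeZero β hβ.ne').toMeasurableEquiv
    (μ := (volume : Measure (EuclideanSpace ℝ (Fin N))))
  have h2 : (⇑(Homeomorph.smulOfNeZero (α := EuclideanSpace ℝ (Fin N)) β hβ.ne').toMeasurableEquiv)
      = (β • ·) := rfl
  rw [h2, Measure.map_addHaar_smul _ hβ.ne', lintegral_smul_measure, smul_eq_mul] at h1
  rw [← h1, finrank_euclideanSpace_fin, Real.rpow_neg hβ.le, Real.rpow_natCast,
    abs_of_pos (inv_pos.2 (pow_pos hβ N))]

variable [NeZero N]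

theorem profile_rescale (r : ℝ) :
    profile (rescale p α u) r = α * profile u (α ^ ((p - 1) / 2) * r) := by
  simp only [profile, rescale]
  congr 2
  ext i
  by_cases h : i = 0 <;> simp [h]

theorem IsInflectionRadius.rescale (hα : 0 < α) {r₀ : ℝ} (hr : IsInflectionRadius u r₀) :
    IsInflectionRadius (rescale p α u) (r₀ / α ^ ((p - 1) / 2)) := by
  set β := α ^ ((p - 1) / 2) with hβdef
  have hβ : 0 < β := Real.rpow_pos_of_pos hα _
  have hdd : ∀ r, deriv (deriv (profile (PucciEnergy.rescale p α u))) r =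
      α * β * β * deriv (deriv (profile u)) (β * r) := by
    intro r
    have h0 : profile (PucciEnergy.rescale p α u) = fun r => α * profile u (β * r) :=
      funext profile_rescale
    have h1 : deriv (profile (PucciEnergy.rescale p α u)) =
        fun r => α * β * deriv (profile u) (β * r) := by
      ext r
      rw [h0, deriv_const_mul_field, deriv_comp_mul_left]
      simp [mul_assoc]
    rw [h1, deriv_const_mul_field, deriv_comp_mul_left]
    simp [mul_assoc]
  have hpos : 0 < α * β * β := by positivity
  refine ⟨div_pos hr.pos hβ, ?_, fun r h1 h2 => ?_, fun r h1 => ?_⟩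
  · rw [hdd, mul_div_cancel₀ _ hβ.ne', hr.zero, mul_zero]
  · rw [hdd]
    rw [lt_div_iff₀ hβ, mul_comm] at h2
    exact mul_neg_of_pos_of_neg hpos (hr.neg_before _ (mul_pos hβ h1) h2)
  · rw [hdd]
    rw [div_lt_iff₀ hβ, mul_comm] at h1
    exact mul_pos hpos (hr.pos_after _ h1)

theorem rescale_mem_X (hα : 0 < α) (hu : u ∈ X N) : rescale p α u ∈ X N := by
  obtain ⟨h1, h2, h3, r₀, h4⟩ := hu
  exact ⟨contDiff_rescale h1, h2.rescale, fun x => mul_pos hα (h3 _), _, h4.rescale hα⟩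

theorem weight_rescale (hα : 0 < α) (hu : u ∈ X N) (x : EuclideanSpace ℝ (Fin N)) :
    weight p (rescale p α u) x =
      (α ^ ((p - 1) / 2)) ^ (-gammaStar N p) * weight p u (α ^ ((p - 1) / 2) • x) := by
  obtain ⟨-, -, -, r₀, hr₀⟩ := hu
  have hβ : 0 < α ^ ((p - 1) / 2) := Real.rpow_pos_of_pos hα _
  rw [weight, weight, (hr₀.rescale hα).inflectionRadius_eq, hr₀.inflectionRadius_eq]
  set β := α ^ ((p - 1) / 2)
  simp only [norm_smul, Real.norm_of_nonneg hβ.le, le_div_iff₀ hβ, mul_comm ‖x‖,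
    Real.rpow_neg hβ.le]
  have hβγ := (Real.rpow_pos_of_pos hβ (gammaStar N p)).ne'
  split_ifs with h
  · rw [Real.div_rpow hr₀.pos.le hβ.le]
    field_simp
  · rw [Real.mul_rpow hβ.le (norm_nonneg x)]
    field_simp

theorem energy_rescale (hp : 1 < p) (hα : 0 < α) (hu : u ∈ X N) :
    energy p (rescale p α u) = energy p u := by
  have hβ : 0 < α ^ ((p - 1) / 2) := Real.rpow_pos_of_pos hα _
  have hpos := hu.2.2.1
  rw [energy, energy]
  simp only [weight_rescale hα hu]
  set β := α ^ ((p - 1) / 2) with hβdef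
  have h1 : ∀ x, ENNReal.ofReal (rescale p α u x ^ (p + 1) *
      (β ^ (-gammaStar N p) * weight p u (β • x))) =
      ENNReal.ofReal (α ^ (p + 1) * β ^ (-gammaStar N p)) *
        ENNReal.ofReal (u (β • x) ^ (p + 1) * weight p u (β • x)) := fun x => by
    rw [← ENNReal.ofReal_mul (by positivity)]
    congr 1
    rw [rescale, Real.mul_rpow hα.le (hpos _).le]
    ring
  simp only [h1]
  rw [lintegral_const_mul' _ _ ENNReal.ofReal_ne_top,
    lintegral_comp_smul_of_pos hβ
      (fun y => ENNReal.ofReal (u y ^ (p + 1) * weight p u y)), ← mul_assoc,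
    ← ENNReal.ofReal_mul (by positivity)]
  -- The powers of α come from u^(p+1), the weight and the Jacobian; γ* is exactly the value for
  -- which they cancel.
  have h2 : α ^ (p + 1) * β ^ (-gammaStar N p) * β ^ (-(N : ℝ)) = 1 := by
    rw [mul_assoc, ← Real.rpow_add hβ, hβdef, ← Real.rpow_mul hα.le, ← Real.rpow_add hα]
    have : p + 1 + (p - 1) / 2 * (-gammaStar N p + -(N : ℝ)) = 0 := by
      have := (sub_pos.2 hp).ne'
      rw [gammaStar]
      field_simp
      ring
    rw [this, Real.rpow_zero]
  rw [h2, ENNReal.ofReal_one, one_mul]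

end rescale

end PucciEnergy

/-! ### Conclusion -/

theorem mainTheorem5 (N : ℕ) [NeZero N] (lam Lam p : ℝ) (hlam : 0 < lam) (hLam : lam ≤ Lam)
    (hN : 2 < PucciEnergy.dimPlus N lam Lam)
    (hp : PucciEnergy.IsCriticalExponent N lam Lam p) :
    (∀ u ∈ PucciEnergy.X N, ∀ α : ℝ, 0 < α →
      PucciEnergy.rescale p α u ∈ PucciEnergy.X N ∧
      PucciEnergy.energy p (PucciEnergy.rescale p α u) = PucciEnergy.energy p u) ∧
    ∃ S : ℝ≥0∞, S < ⊤ ∧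
      ∀ U : EuclideanSpace ℝ (Fin N) → ℝ,
        PucciEnergy.IsRadialSolution lam Lam p U → U 0 = 1 →
        U ∈ PucciEnergy.X N ∧ PucciEnergy.energy p U = S ∧
        ∀ α : ℝ, 0 < α →
          PucciEnergy.IsRadialSolution lam Lam p (PucciEnergy.rescale p α U) ∧
          PucciEnergy.rescale p α U ∈ PucciEnergy.X N ∧
          PucciEnergy.energy p (PucciEnergy.rescale p α U) = S := by
  obtain ⟨hp1, V, hV, hfast⟩ := hp
  have hN1 : 1 < N := by
    by_contra! hle
    have h1 : (N : ℝ) ≤ 1 := by exact_mod_cast hle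
    have h2 : lam / Lam * ((N : ℝ) - 1) ≤ 0 :=
      mul_nonpos_of_nonneg_of_nonpos (div_nonneg hlam.le (hlam.le.trans hLam)) (by linarith)
    rw [PucciEnergy.dimPlus] at hN
    linarith
  have hV0 := hV.apply_zero_pos hlam hLam hN1 hfast
  have hVX := hV.mem_X hlam hLam hN1 hp1 hfast
  refine ⟨fun u hu α hα => ⟨PucciEnergy.rescale_mem_X hα hu,
    PucciEnergy.energy_rescale hp1 hα hu⟩, PucciEnergy.energy p V, ?_, fun U hU hU0 => ?_⟩
  · have hlt := hV.decay_exponent_lt hlam hLam hN1 hp1 hfast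
    obtain ⟨c, -, hlim, -⟩ := hfast
    exact PucciEnergy.energy_lt_top hp1 hVX hlt hlim
  · have hα : 0 < (V 0)⁻¹ := inv_pos.2 hV0
    -- The factor 1/V(0) normalises V to the value 1 at the origin, where uniqueness applies; U
    -- needs no decay assumption of its own.
    have hUV : U = PucciEnergy.rescale p (V 0)⁻¹ V := by
      refine hU.eq_of_apply_zero_eq hlam hLam hN1 hp1.le (hV.rescale hα) (by rw [hU0]; exact one_pos) ?_
      rw [hU0, PucciEnergy.rescale, smul_zero, inv_mul_cancel₀ hV0.ne']
    have hUX : U ∈ PucciEnergy.X N := hUV ▸ PucciEnergy.rescale_mem_X hα hVX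
    have hUE : PucciEnergy.energy p U = PucciEnergy.energy p V := by
      rw [hUV, PucciEnergy.energy_rescale hp1 hα hVX]
    exact ⟨hUX, hUE, fun α hα => ⟨hU.rescale hα, PucciEnergy.rescale_mem_X hα hUX,
      (PucciEnergy.energy_rescale hp1 hα hUX).trans hUE⟩⟩
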